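/- Let $P$ be a strictly convex polygon with $n\ge 3$ vertices, given as an array in clockwise order. A triangle is \emph{$P$-aligned} if its vertices are vertices of $P$, and \emph{rooted at} a vertex $r$ if it is $P$-aligned and has $r$ as a vertex. Two $P$-aligned triangles \emph{interleave} if between every two cyclically successive vertices of either one there is a vertex of the other (possibly coinciding with one of them). Consider the following recursive algorithm. If $n\le 9$, compute a largest-area rooted triangle for every root and return the largest one. Otherwise: (1) choose an arbitrary vertex $a$ and compute a largest-area triangle $T_a$ rooted at $a$, by a linear sweep in which the second vertex $b$ runs once along the polygon and the third vertex $c$ only moves forward, as long as the area of $\triangle abc$ does not decrease; (2) let $m$ be the median vertex of a largest one (in number of vertices) of the three boundary intervals cut out by $T_a$, and compute in the same way a largest-area triangle $T_m$ rooted at $m$; (3) the vertices $x_0\le x_1\le\dots\le x_5$ of $T_a$ and $T_m$, in order along the boundary, cut it into six intervals sharing their endpoints; let $P'$ be the polygon on the vertices in $[x_0,x_1]\cup[x_2,x_3]\cup[x_4,x_5]$ and $P''$ the polygon on the vertices in $[x_1,x_2]\cup[x_3,x_4]\cup[x_5,x_0]$; (4) if $T_a$ and $T_m$ interleave, recurse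 on $P'$ and $P''$ and return the larger result; otherwise recurse only on $P'$ if each of the pairs $\{x_1,x_2\},\{x_3,x_4\},\{x_5,x_0\}$ contains a vertex of $T_a$ and a vertex of $T_m$ (i.e. $P'$ can contain a triangle that interleaves with both), and only on $P''$ if not. Then the following hold. (i) For every vertex $r$ of $P$, the sweep at $r$ returns a triangle of largest area among all triangles rooted at $r$. (ii) If $n\ge 4$, then for every choice of $a$ the one or two subproblems produced by (1)--(4) are convex polygons on vertices of $P$ with at most $\frac56(n+6)$ vertices each, and every $P$-aligned triangle that has the largest area among all triangles contained in $P$ has all three vertices in at least one of them. (iii) There is an absolute constant $C$ such that for every $P$, and whatever roots $a$ are chosen in the recursive calls, the algorithm terminates after at most $C\,n\log n$ elementary operations (real RAM with unit cost for arithmetic, comparisons, reading an array entry and appending to an array) and returns a $P$-aligned triangle whose area is the largest among all triangles contained in $P$. -/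

import Mathlib

noncomputable section

namespace InscribedTriangle

/-! ### Geometry -/

/-- A point of the plane. -/
abbrev Pt : Type := ℝ × ℝ

/-- A triangle, given by its three vertices. -/
abbrev Tri : Type := Pt × Pt × Pt

/-- Twice the signed area of the triangle `p q r`; it is negative iff `p, q, r` is a clockwise turn. -/
def cross (p q r : Pt) : ℝ :=
  (q.1 - p.1) * (r.2 - p.2) - (q.2 - p.2) * (r.1 - p.1)

/-- The area of a triangle. -/
def area (T : Tri) : ℝ := |cross T.1 T.2.1 T.2.2| / 2

/-- The vertex with cyclic index `i` of the polygon stored in the array `P`. -/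
def vtx (P : Array Pt) (i : ℕ) : Pt := P.getD (i % P.size) 0

/-- The array `P` lists the vertices of a (strictly) convex polygon in clockwise order. -/
def IsConvexPolygon (P : Array Pt) : Prop :=
  3 ≤ P.size ∧ ∀ i j k : ℕ, i < j → j < k → k < P.size → cross (vtx P i) (vtx P j) (vtx P k) < 0

/-- All three vertices of `T` are vertices of the polygon `P`. -/
def Aligned (P : Array Pt) (T : Tri) : Prop := T.1 ∈ P ∧ T.2.1 ∈ P ∧ T.2.2 ∈ P

/-- The (closed) region bounded by the convex polygon `P`. -/
def region (P : Array Pt) : Set Pt := convexHull ℝ {p | p ∈ P}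

/-- `T` has its vertices among those of `P`, and its area is the largest one
among all triangles contained in `P`. -/
def IsLargest (P : Array Pt) (T : Tri) : Prop :=
  Aligned P T ∧ ∀ p ∈ region P, ∀ q ∈ region P, ∀ r ∈ region P, area (p, q, r) ≤ area T

/-- `T` has its vertices among those of `P`, one of them is `v`, and `T` has the largest area
among all such triangles. -/
def IsLargestRooted (P : Array Pt) (v : Pt) (T : Tri) : Prop :=
  (Aligned P T ∧ T.1 = v) ∧ ∀ q ∈ P, ∀ r ∈ P, area (v, q, r) ≤ area T

/-! ### Counting steps

The model is a real RAM. Elementary operations, each of unit cost, are: an arithmetic operation,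
comparison or logical operation on real numbers, indices or truth values; reading an entry of an
array; appending an entry to an array. -/

/-- A computation: its result, together with the number of elementary operations it performs. -/
structure Timed (α : Type) where
  val : α
  time : ℕ

instance : Monad Timed where
  pure a := ⟨a, 0⟩
  bind x f := ⟨(f x.val).val, x.time + (f x.val).time⟩

/-- `ops k a` is straight-line code of at most `k` elementary operations with result `a`.
It is only used with numerals `k`. -/
def ops {α : Type} (k : ℕ) (a : α) : Timed α := ⟨a, k⟩

/-! ### The largest triangle rooted at a vertex

Vertices are addressed by their offset from the root `r` along the polygon. -/

/-- The triangle with vertices at offsets `0`, `b`, `c` from the vertex with index `r`. -/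
def triAt (P : Array Pt) (r b c : ℕ) : Tri := (vtx P r, vtx P (r + b), vtx P (r + c))

/-- Advance the third vertex `c` as long as this does not decrease the area. -/
def climb (P : Array Pt) (r b c : ℕ) : Timed ℕ :=
  if _h : c + 1 < P.size then do
    let up ← ops 50 (decide (area (triAt P r b c) ≤ area (triAt P r b (c + 1))))
    if up then climb P r b (c + 1) else pure c
  else ops 2 c
termination_by P.size - c

/-- For the remaining positions of the second vertex `b`, advance `c` (which is never moved back)
and keep the best triangle seen. -/
def sweep (P : Array Pt) (r b c : ℕ) (best : ℕ × ℕ) : Timed (ℕ × ℕ) :=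
  if _h : b + 1 < P.size then do
    let c₀ ← ops 4 (max c (b + 1))
    let c₁ ← climb P r b c₀
    let better ← ops 50 (decide (area (triAt P r best.1 best.2) < area (triAt P r b c₁)))
    sweep P r (b + 1) c₁ (if better then (b, c₁) else best)
  else ops 2 best
termination_by P.size - b

/-- Offsets `(b, c)`, `b < c`, of the other two vertices of the triangle found for the root `r`. -/
def rootedOffsets (P : Array Pt) (r : ℕ) : Timed (ℕ × ℕ) := sweep P r 1 2 (1, 2)

/-- The triangle found for the root with index `r`. -/
def rootedTriangle (P : Array Pt) (r : ℕ) : Timed Tri := do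
  let o ← rootedOffsets P r
  ops 12 (triAt P r o.1 o.2)

/-! ### Dividing a polygon

Below, `a` is the root of the first dividing triangle, and all vertices are addressed by their
offsets from `a`, which are numbers in `{0, …, n - 1}`. -/

/-- First vertex and length (number of edges) of a longest one of the three intervals into which
the vertices `0 < b < c` cut the boundary of an `n`-gon. -/
def longestInterval (n b c : ℕ) : ℕ × ℕ :=
  if c - b ≤ b ∧ n - c ≤ b then (0, b)
  else if n - c ≤ c - b then (b, c - b)
  else (c, n - c)

/-- For increasing triples `u`, `v`: between every two cyclically successive members of `u`
there is a member of `v`, possibly coinciding with one of them. -/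
def Separates (v u : List ℕ) : Prop :=
  (∃ x ∈ v, u.getD 0 0 ≤ x ∧ x ≤ u.getD 1 0) ∧ (∃ x ∈ v, u.getD 1 0 ≤ x ∧ x ≤ u.getD 2 0) ∧
    (∃ x ∈ v, u.getD 2 0 ≤ x ∨ x ≤ u.getD 0 0)

/-- The triangles with vertices at the offsets in the increasing triples `u` and `v` interleave. -/
def Interleave (u v : List ℕ) : Prop := Separates v u ∧ Separates u v

/-- One of `x`, `y` belongs to `u`, and one of them belongs to `v`. -/
def Mixed (u v : List ℕ) (x y : ℕ) : Prop := (x ∈ u ∨ y ∈ u) ∧ (x ∈ v ∨ y ∈ v)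

open Classical in
/-- The polygon formed by the vertices with offset `i < k` from `a` that satisfy `keep i`. -/
def select (P : Array Pt) (a : ℕ) (keep : ℕ → Prop) : ℕ → Timed (Array Pt)
  | 0 => ops 1 #[]
  | k + 1 => do
    let Q ← select P a keep k
    let t ← ops 40 (decide (keep k))
    if t then ops 6 (Q.push (vtx P (a + k))) else pure Q

/-- One or two subproblems. -/
inductive Split where
  | one (Q : Array Pt)
  | two (Q R : Array Pt)

/-- The list of the subproblems. -/
def Split.parts : Split → List (Array Pt)
  | .one Q => [Q]
  | .two Q R => [Q, R]

open Classical in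
/-- The six vertices of the dividing triangles, `X 0 ≤ ⋯ ≤ X 5` along the boundary, cut it into six
intervals that share their endpoints; the two candidate subpolygons consist of every other interval.
A triangle with one vertex in each of the intervals of the first candidate is separated by the
pairs `{X 1, X 2}`, `{X 3, X 4}`, `{X 5, X 0}`, so it can interleave with both dividing triangles
iff each of these pairs contains a vertex of either of them. -/
def divide (P : Array Pt) (a : ℕ) : Timed Split := do
  let n := P.size
  let oa ← rootedOffsets P a
  let I ← ops 12 (longestInterval n oa.1 oa.2)
  let m ← ops 2 (I.1 + I.2 / 2)
  let r ← ops 2 ((a + m) % n)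
  let om ← rootedOffsets P r
  let Ta ← ops 3 [0, oa.1, oa.2]
  let Tm ← ops 30 (List.insertionSort (· ≤ ·) [m, (m + om.1) % n, (m + om.2) % n])
  let L ← ops 60 (List.insertionSort (· ≤ ·) (Ta ++ Tm))
  let X : ℕ → ℕ := fun i => L.getD i 0
  let P₁ ← select P a (fun i => X 0 ≤ i ∧ i ≤ X 1 ∨ X 2 ≤ i ∧ i ≤ X 3 ∨ X 4 ≤ i ∧ i ≤ X 5) n
  let P₂ ← select P a (fun i => X 1 ≤ i ∧ i ≤ X 2 ∨ X 3 ≤ i ∧ i ≤ X 4 ∨ X 5 ≤ i ∨ i ≤ X 0) n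
  let both ← ops 100 (decide (Interleave Ta Tm))
  if both then
    pure (.two P₁ P₂)
  else
    let first ← ops 100 (decide
      (Mixed Ta Tm (X 1) (X 2) ∧ Mixed Ta Tm (X 3) (X 4) ∧ Mixed Ta Tm (X 5) (X 0)))
    if first then pure (.one P₁) else pure (.one P₂)

/-! ### The divide-and-conquer algorithm -/

/-- The larger one of two triangles. -/
def larger (T S : Tri) : Timed Tri := do
  let t ← ops 50 (decide (area T ≤ area S))
  if t then pure S else pure T

/-- The larger one of two results; `none` stands for a call that has not returned. -/
def largerResult : Option Tri → Option Tri → Timed (Option Tri)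
  | some T, some S => do
    let U ← larger T S
    pure (some U)
  | _, _ => pure none

/-- The largest one of the triangles found for the roots `0, …, k`. -/
def bestOverRoots (P : Array Pt) : ℕ → Timed Tri
  | 0 => rootedTriangle P 0
  | k + 1 => do
    let T ← bestOverRoots P k
    let S ← rootedTriangle P (k + 1)
    larger T S

/-- The recursive procedure. Polygons of constant size, at most nine vertices, are solved directly.
The number `choice path` selects the root in the call that is reached from the initial call by the
sequence `path` of first / second recursive calls, so a function `choice` is an arbitrary sequence
of choices of roots. The first explicit argument bounds the depth of the recursion; the result is
`none` if that bound was ever exceeded. -/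
def solve (choice : List Bool → ℕ) : ℕ → List Bool → Array Pt → Timed (Option Tri)
  | 0, _, _ => pure none
  | d + 1, path, P => do
    let small ← ops 1 (decide (P.size ≤ 9))
    if small then
      let T ← bestOverRoots P (P.size - 1)
      pure (some T)
    else
      let a ← ops 2 (choice path % P.size)
      let s ← divide P a
      match s with
      | .one Q => solve choice d (false :: path) Q
      | .two Q R => do
        let T ← solve choice d (false :: path) Q
        let S ← solve choice d (true :: path) R
        largerResult T S

/-- The divide-and-conquer algorithm on the polygon `P`, with arbitrary roots given by `choice`. -/
def largestTriangle (choice : List Bool → ℕ) (P : Array Pt) : Timed (Option Tri) :=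
  solve choice P.size [] P

end InscribedTriangle

end

/-! The heart of the matter is that a largest triangle `T` interleaves with every triangle that is
largest for one of its vertices (`IsCyclicConvex.interleave`). If interleaving fails, an arc `i₀ i₁`
of one triangle lies strictly inside an arc `o₀ o₁` of the other. When replacing `o₁` by `i₁` does
not enlarge the outer triangle, the reverse replacement strictly enlarges the inner one
(`IsCyclicConvex.exchange`), because the order of distances from a line is kept as the line turns
forward. This contradicts optimality unless the vertex exchanged is the root of the rooted triangle.
In that remaining case two vertices are replaced at once: `cw_lt_of_max` says that a rooted triangle
placed in this way is beaten by the one that keeps its root and takes two vertices of the global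
optimum.

Hence between successive vertices of `T` there is one vertex of `T_a` and one of `T_m`, so the six
merged vertices form three pairs separated by `T`. Either the pairs are `{X 0, X 1}, {X 2, X 3}, {X
4, X 5}`, and `T` lives on the second candidate, or they are `{X 1, X 2}, {X 3, X 4}, {X 5, X 0}`,
and `T` lives on the first (`exists_pattern`). Unless `T_a` and `T_m` interleave, the mixing test
tells these cases apart. Each subproblem omits an arc from the median `m` to a vertex of `T_a`. The
longest interval has at least `n / 3` edges, so this arc has about `n / 6` or more (`median_spec`,
`divide_spec`).

The sweep is linear and exact, since for fixed `b` the area is unimodal in `c`, and an ascent in `c`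
persists when `b` advances. Two subproblems share at most six vertices, so `n - 6` is superadditive
under division while every size shrinks by a constant factor; the potential `K (n - 6) log n` then
gives the time bound (`solve_time_le`). -/

namespace InscribedTriangle

/-! ### Clockwise area and its monotonicity -/

/-- Twice the signed area of a triangle, positive for clockwise triangles. -/
def cw (p q r : Pt) : ℝ := -cross p q r

theorem cw_rotate (p q r : Pt) : cw q r p = cw p q r := by
  simp only [cw, cross]; ring

theorem cw_swap (p q r : Pt) : cw p r q = -cw p q r := by
  simp only [cw, cross]; ring

theorem area_eq_abs_cw (p q r : Pt) : area (p, q, r) = |cw p q r| / 2 := by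
  simp only [area, cw, abs_neg]

theorem cw_self_left (p q : Pt) : cw p p q = 0 := by
  simp only [cw, cross]; ring

theorem cw_self_right (p q : Pt) : cw p q q = 0 := by
  simp only [cw, cross]; ring

theorem cw_self_outer (p q : Pt) : cw p q p = 0 := by
  simp only [cw, cross]; ring

/-- If moving `x` to `y` does not decrease the area over the base `p q`, it increases the area over
the base `p q'` when the second endpoint moves forward. -/
theorem cw_lt_of_base_end {p q q' x y : Pt} (hqx : 0 < cw p q x) (hq'x : 0 ≤ cw p q' x)
    (hqq' : 0 < cw p q q') (hxy : 0 < cw p x y) (h : cw p q x ≤ cw p q y) :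
    cw p q' x < cw p q' y := by
  -- The three-term Plücker relation for the vectors from `p` to `q`, `q'`, `x`, `y`.
  have key : cw p q x * (cw p q' y - cw p q' x) =
      cw p q' x * (cw p q y - cw p q x) + cw p q q' * cw p x y := by
    simp only [cw, cross]; ring
  have h1 := mul_nonneg hq'x (sub_nonneg.2 h)
  have h2 := mul_pos hqq' hxy
  have : 0 < cw p q' y - cw p q' x := by
    by_contra hc
    have := mul_nonpos_of_nonneg_of_nonpos hqx.le (not_lt.1 hc)
    linarith
  linarith

/-- If moving `x` to `y` does not decrease the area over the base `p q`, it increases the area over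
the base `p' q` when the first endpoint moves forward. -/
theorem cw_lt_of_base_start {p p' q x y : Pt} (hqx : 0 < cw p q x) (hp'x : 0 ≤ cw p' q x)
    (hpp' : 0 < cw p p' q) (hxy : 0 < cw q x y) (h : cw p q x ≤ cw p q y) :
    cw p' q x < cw p' q y := by
  have key : cw p q x * (cw p' q y - cw p' q x) =
      cw p' q x * (cw p q y - cw p q x) + cw p p' q * cw q x y := by
    simp only [cw, cross]; ring
  have h1 := mul_nonneg hp'x (sub_nonneg.2 h)
  have h2 := mul_pos hpp' hxy
  have : 0 < cw p' q y - cw p' q x := by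
    by_contra hc
    have := mul_nonpos_of_nonneg_of_nonpos hqx.le (not_lt.1 hc)
    linarith
  linarith

/-- Along a convex chain `x y z` the distance from the line `p q` cannot first decrease and then
not decrease. -/
theorem cw_unimodal {p q x y z : Pt} (hpxy : 0 < cw p x y) (hpyz : 0 < cw p y z)
    (hxyz : 0 < cw x y z) (hy : 0 < cw p q y) (h : cw p q y < cw p q x) :
    cw p q z < cw p q y := by
  by_contra hc
  have hc := not_lt.1 hc
  -- This is the Plücker relation at `p`; `key2` equates the two triangulations of the quadrilateral
  -- `p x y z`. Together they bound the value at `y` below by more than a weighted mean of its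
  -- neighbours would allow.
  have key : cw p x z * cw p q y = cw p y z * cw p q x + cw p x y * cw p q z := by
    simp only [cw, cross]; ring
  have key2 : cw x y z + cw p x z = cw p y z + cw p x y := by
    simp only [cw, cross]; ring
  have h1 := mul_lt_mul_of_pos_left h hpyz
  have h2 := mul_le_mul_of_nonneg_left hc hpxy.le
  have h3 := mul_pos hxyz hy
  have : (cw x y z + cw p x z) * cw p q y = (cw p y z + cw p x y) * cw p q y := by rw [key2]
  nlinarith

/-- The affine normal form of `cw_lt_of_max`. -/
theorem normalized_lt {s u p q x y : ℝ} (hs1 : s < 1) (hs0 : 0 ≤ s) (hsu : s < u)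
    (hp : 0 ≤ p) (hq : q ≤ 1) (hpq : 1 ≤ p + q) (hconv : s * q < u * (1 - p))
    (hconv' : 0 ≤ (p - 1 + s) * (1 - u) + (q - u) * (1 - s))
    (hx : 0 ≤ x) (hxy : x ≤ y) (hmax : q - y + x * q + y * p ≤ 1)
    (hne : 0 < p ∨ q < 1 ∨ 0 < y) :
    (1 - s) * q - u * p + x * (q - u) - y * (1 - s - p) < 1 - s := by
  have hu : 0 < u := lt_of_le_of_lt hs0 hsu
  -- The coordinates are `T₀ = (0, 0)`, `T₁ = (1, 0)`, `T₂ = (0, 1)`, `A₁ = (1 - s, u)`, `A₂ = (p,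
  -- q)`, `A₀ = (-x, y)`. By convexity `A₂` is strictly closer than `A₁` to the line `T₀ T₂`.
  have hsp : 0 < 1 - s - p := by
    by_contra hc
    have hc := not_lt.1 hc
    have hp1 : p < 1 := by nlinarith
    have hs : 0 < s := by nlinarith
    have hqu : q < u := by nlinarith
    have : 0 ≤ (p - 1 + s) * (s - u) := by
      by_cases hu1 : u ≤ 1
      · nlinarith
      · nlinarith
    nlinarith
  -- The sign tells which of `A₁`, `A₂` is farther from the line `T₁ T₂`. If it is not `A₂`, the
  -- deficit splits into the nonnegative terms `h1` to `h4`, and `hne` makes one of them strict.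
  rcases le_or_gt (p + q - 1 - (u - s)) 0 with hk | hk
  · have h1 : x * (p + q - 1 - (u - s)) ≤ 0 := mul_nonpos_of_nonneg_of_nonpos hx hk
    have h2 : 0 ≤ (y - x) * (1 - s - p) := mul_nonneg (by linarith) hsp.le
    have h3 : 0 ≤ (1 - s) * (1 - q) := mul_nonneg (by linarith) (by linarith)
    have h4 : 0 ≤ u * p := mul_nonneg hu.le hp
    rcases hne with h | h | h
    · have := mul_pos hu h
      nlinarith
    · have : 0 < (1 - s) * (1 - q) := mul_pos (by linarith) (by linarith)
      nlinarith
    · rcases hp.eq_or_lt with h0 | h0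
      · rcases hx.eq_or_lt with hx0 | hx0
        · have : 0 < (y - x) * (1 - s - p) := mul_pos (by linarith) hsp
          nlinarith
        · have : x * (p + q - 1 - (u - s)) < 0 :=
            mul_neg_of_pos_of_neg hx0 (by linarith)
          nlinarith
      · have := mul_pos hu h0
        nlinarith
  · have hk0 : 0 < p + q - 1 := by linarith
    have hl : 0 ≤ (p + q - 1 - (u - s)) * (1 - (q - y + x * q + y * p)) :=
      mul_nonneg hk.le (by linarith)
    have hm : 0 ≤ (u * (1 - p) - s * q) * (y - x) := mul_nonneg (by linarith) (by linarith)
    have hq1 : 0 ≤ (u - s) * (1 - q) := mul_nonneg (by linarith) (by linarith)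
    have h5 : 0 < u * (p + q - 1) := mul_pos hu hk0
    have h6 : 0 < (p + q - 1) * (u * (p + q - 1)) := mul_pos hk0 h5
    have h7 : 0 ≤ (p + q - 1) * ((u - s) * (1 - q)) := mul_nonneg hk0.le hq1
    -- The product is exactly the sum of the left-out quantities in `hl`, `hm`, `hq1`, `h6` and
    -- `h7`; the slack of `hmax` enters through `hl`.
    have : 0 < (p + q - 1) *
        (1 - s - ((1 - s) * q - u * p + x * (q - u) - y * (1 - s - p))) := by
      nlinarith
    have := (mul_pos_iff_of_pos_left hk0).1 this
    linarith

/-- Signed areas in the affine coordinates in which `T₀ T₁ T₂` is the standard triangle. -/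
theorem cw_eq_affine {T₀ T₁ T₂ : Pt} (hT : cw T₀ T₁ T₂ ≠ 0) (X Y Z : Pt) :
    cw X Y Z = cw T₀ T₁ T₂ *
      ((cw T₀ Y T₂ / cw T₀ T₁ T₂ - cw T₀ X T₂ / cw T₀ T₁ T₂) *
          (cw T₀ T₁ Z / cw T₀ T₁ T₂ - cw T₀ T₁ X / cw T₀ T₁ T₂) -
        (cw T₀ T₁ Y / cw T₀ T₁ T₂ - cw T₀ T₁ X / cw T₀ T₁ T₂) *
          (cw T₀ Z T₂ / cw T₀ T₁ T₂ - cw T₀ X T₂ / cw T₀ T₁ T₂)) := by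
  field_simp
  simp only [cw, cross]
  ring

/-- Let `T₀ T₁ T₂` be a largest triangle and `T₀, T₁, A₁, A₂, T₂, A₀` be in convex position, in this
order. Then `A₀ A₁ A₂` is smaller than `T₀ A₁ T₂`. -/
theorem cw_lt_of_max {T₀ T₁ T₂ A₀ A₁ A₂ : Pt} (hT : 0 < cw T₀ T₁ T₂)
    (hA₁ : 0 < cw T₀ A₁ T₂) (hcap : 0 < cw T₁ A₁ T₂) (hA₂ : 0 ≤ cw T₀ A₂ T₂)
    (hcap' : 0 ≤ cw T₁ A₂ T₂) (hc : 0 < cw T₁ A₁ A₂) (hc' : 0 ≤ cw A₁ A₂ T₂)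
    (hA₀ : 0 ≤ cw T₂ A₀ T₀)
    (m1 : cw T₀ A₁ T₂ ≤ cw T₀ T₁ T₂) (m2 : cw T₀ T₁ A₂ ≤ cw T₀ T₁ T₂)
    (m3 : cw A₀ T₁ T₂ ≤ cw T₀ T₁ T₂) (m4 : cw A₀ T₁ A₂ ≤ cw T₀ T₁ T₂)
    (hne : 0 < cw T₀ A₂ T₂ ∨ 0 < cw T₀ T₁ A₀) :
    cw A₀ A₁ A₂ < cw T₀ A₁ T₂ := by
  have hT' := hT.ne'
  have e := cw_eq_affine hT'
  have eT₀x : cw T₀ T₀ T₂ = 0 := cw_self_left _ _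
  have eT₀y : cw T₀ T₁ T₀ = 0 := cw_self_outer _ _
  have eT₁y : cw T₀ T₁ T₁ = 0 := cw_self_right _ _
  have eT₂x : cw T₀ T₂ T₂ = 0 := cw_self_right _ _
  have eA₀ : cw T₂ A₀ T₀ = -cw T₀ A₀ T₂ := by simp only [cw, cross]; ring
  rw [eA₀] at hA₀
  generalize hD : cw T₀ T₁ T₂ = D at *
  rw [e T₁ A₁ T₂] at hcap
  rw [e T₁ A₂ T₂] at hcap'
  rw [e T₁ A₁ A₂] at hc
  rw [e A₁ A₂ T₂] at hc'
  rw [e A₀ T₁ T₂] at m3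
  rw [e A₀ T₁ A₂] at m4
  rw [e A₀ A₁ A₂]
  have hDD : D / D = 1 := div_self hT'
  simp only [hD, eT₁y, eT₂x, hDD, zero_div, mul_pos_iff_of_pos_left hT,
    mul_nonneg_iff_of_pos_left hT] at hcap hcap' hc hc' m3 m4 ⊢
  obtain ⟨a, ha⟩ : ∃ a, a = cw T₀ A₁ T₂ / D := ⟨_, rfl⟩
  have ha' : cw T₀ A₁ T₂ = D * a := by rw [ha]; field_simp
  obtain ⟨p, hp⟩ : ∃ p, p = cw T₀ A₂ T₂ / D := ⟨_, rfl⟩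
  have hp' : cw T₀ A₂ T₂ = D * p := by rw [hp]; field_simp
  obtain ⟨q, hq⟩ : ∃ q, q = cw T₀ T₁ A₂ / D := ⟨_, rfl⟩
  have hq' : cw T₀ T₁ A₂ = D * q := by rw [hq]; field_simp
  obtain ⟨x, hx⟩ : ∃ x, x = cw T₀ A₀ T₂ / D := ⟨_, rfl⟩
  have hx' : cw T₀ A₀ T₂ = D * x := by rw [hx]; field_simp
  obtain ⟨y, hy⟩ : ∃ y, y = cw T₀ T₁ A₀ / D := ⟨_, rfl⟩
  have hy' : cw T₀ T₁ A₀ = D * y := by rw [hy]; field_simp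
  obtain ⟨u, hu⟩ : ∃ u, u = cw T₀ T₁ A₁ / D := ⟨_, rfl⟩
  simp only [← ha, ← hp, ← hq, ← hx, ← hy, ← hu] at *
  simp only [ha', hp', hq', hx', hy', mul_pos_iff_of_pos_left hT,
    mul_nonneg_iff_of_pos_left hT] at *
  have k1 : a ≤ 1 := le_of_mul_le_mul_left (by linarith) hT
  have k2 : q ≤ 1 := le_of_mul_le_mul_left (by linarith) hT
  have k3 := le_of_mul_le_mul_left (m3.trans_eq (mul_one D).symm) hT
  have k4 := le_of_mul_le_mul_left (m4.trans_eq (mul_one D).symm) hT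
  have k5 : 0 ≤ -x := by
    have : 0 ≤ D * -x := by linarith
    exact (mul_nonneg_iff_of_pos_left hT).1 this
  refine mul_lt_mul_of_pos_left ?_ hT
  have := normalized_lt (s := 1 - a) (u := u) (p := p) (q := q) (x := -x) (y := y)
    (by linarith) (by linarith) (by linarith) hA₂ k2 (by linarith) (by linarith) (by linarith)
    k5 (by linarith) (by linarith) (hne.imp_right Or.inr)
  linarith

/-! ### Cyclic sequences of points in convex position -/

/-- The sequence `V` runs periodically, with period `n`, through the vertices of a strictly convex
polygon in clockwise order. -/
structure IsCyclicConvex (n : ℤ) (V : ℤ → Pt) : Prop where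
  periodic : ∀ i, V (i + n) = V i
  pos : ∀ {i j k}, i < j → j < k → k < i + n → 0 < cw (V i) (V j) (V k)

/-- No triangle on the points of `V` is larger than that with indices `i, j, k`. -/
def IsMaxAll (V : ℤ → Pt) (i j k : ℤ) : Prop :=
  ∀ a b c, cw (V a) (V b) (V c) ≤ cw (V i) (V j) (V k)

/-- No triangle on the points of `V` with vertex `V r` is larger than that with indices
`i, j, k`. -/
def IsMaxThrough (V : ℤ → Pt) (r i j k : ℤ) : Prop :=
  ∀ b c, cw (V r) (V b) (V c) ≤ cw (V i) (V j) (V k)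

/-- The triangle with indices `i, j, k` is largest among those sharing a certain one of its
vertices. -/
def IsMaxRooted (V : ℤ → Pt) (i j k : ℤ) : Prop :=
  IsMaxThrough V i i j k ∨ IsMaxThrough V j i j k ∨ IsMaxThrough V k i j k

/-- One of the two triangles is largest among all, the other one among those with a common root. -/
def IsMaxPair (V : ℤ → Pt) (o₀ o₁ o₂ i₀ i₁ i₂ : ℤ) : Prop :=
  IsMaxRooted V o₀ o₁ o₂ ∧ IsMaxAll V i₀ i₁ i₂ ∨ IsMaxAll V o₀ o₁ o₂ ∧ IsMaxRooted V i₀ i₁ i₂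

/-- The reflected sequence, run through backwards. -/
def mirror (V : ℤ → Pt) (i : ℤ) : Pt := (-(V (-i)).1, (V (-i)).2)

theorem cw_mirror (V : ℤ → Pt) (i j k : ℤ) :
    cw (mirror V i) (mirror V j) (mirror V k) = cw (V (-k)) (V (-j)) (V (-i)) := by
  simp only [cw, cross, mirror]; ring

namespace IsCyclicConvex

variable {n : ℤ} {V : ℤ → Pt}

theorem periodic_sub (h : IsCyclicConvex n V) (i : ℤ) : V (i - n) = V i := by
  rw [← h.periodic (i - n), sub_add_cancel]

theorem nonneg (h : IsCyclicConvex n V) {i j k : ℤ} (hij : i ≤ j) (hjk : j ≤ k) (hk : k ≤ i + n) :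
    0 ≤ cw (V i) (V j) (V k) := by
  rcases hij.eq_or_lt with rfl | hij
  · rw [cw_self_left]
  rcases hjk.eq_or_lt with rfl | hjk
  · rw [cw_self_right]
  rcases hk.eq_or_lt with rfl | hk
  · rw [h.periodic, cw_self_outer]
  · exact (h.pos hij hjk hk).le

theorem mirror (h : IsCyclicConvex n V) : IsCyclicConvex n (mirror V) where
  periodic i := by
    have : V (-(i + n)) = V (-i) := by rw [neg_add', h.periodic_sub]
    simp only [InscribedTriangle.mirror, this]
  pos hij hjk hk := by
    rw [cw_mirror]
    exact h.pos (by omega) (by omega) (by omega)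

theorem shift (h : IsCyclicConvex n V) (a : ℤ) : IsCyclicConvex n (fun i => V (a + i)) where
  periodic i := by rw [← add_assoc, h.periodic]
  pos hij hjk hk := h.pos (by omega) (by omega) (by omega)

/-- Exchange of one vertex between two triangles. -/
theorem exchange (h : IsCyclicConvex n V) {o₀ o₁ o₂ i₀ i₁ i₂ : ℤ} (h1 : o₀ < i₀) (h2 : i₀ < i₁)
    (h3 : i₁ < o₁) (h4 : o₁ < o₂) (h5 : o₂ ≤ i₂) (h6 : i₂ < i₀ + n) (h7 : o₂ < o₀ + n)
    (hle : cw (V o₀) (V i₁) (V o₂) ≤ cw (V o₀) (V o₁) (V o₂)) :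
    cw (V i₀) (V i₁) (V i₂) < cw (V i₀) (V o₁) (V i₂) := by
  have e1 := cw_rotate (V (o₂ - n)) (V o₀)
  have e2 := cw_rotate (V (i₂ - n)) (V i₀)
  rw [h.periodic_sub] at e1 e2
  rw [e1, e1] at hle
  rw [e2, e2]
  rw [← h.periodic_sub o₂] at hle
  rw [← h.periodic_sub i₂]
  -- The base `o₂ - n, o₀` is carried to `i₂ - n, i₀` by advancing first its end and then its start.
  have s1 := cw_lt_of_base_end (q' := V i₀) (h.pos (by omega) (by omega) (by omega))
    (h.nonneg (by omega) (by omega) (by omega)) (h.pos (by omega) (by omega) (by omega))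
    (h.pos (by omega) (by omega) (by omega)) hle
  rcases h5.eq_or_lt with rfl | h5
  · exact s1
  · exact cw_lt_of_base_start (h.pos (by omega) (by omega) (by omega))
      (h.nonneg (by omega) (by omega) (by omega)) (h.pos (by omega) (by omega) (by omega))
      (h.pos (by omega) (by omega) (by omega)) s1.le

theorem exchange' (h : IsCyclicConvex n V) {o₀ o₁ o₂ i₀ i₁ i₂ : ℤ} (h1 : o₀ < i₀) (h2 : i₀ < i₁)
    (h3 : i₁ < o₁) (h4 : o₂ < o₀ + n) (h5 : i₂ ≤ o₂) (h6 : i₁ < i₂) (h7 : o₁ < o₂)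
    (hle : cw (V i₀) (V o₁) (V o₂) ≤ cw (V o₀) (V o₁) (V o₂)) :
    cw (V i₀) (V i₁) (V i₂) < cw (V o₀) (V i₁) (V i₂) := by
  have := h.mirror.exchange (o₀ := -o₁) (o₁ := -o₀) (o₂ := -o₂ + n) (i₀ := -i₁) (i₁ := -i₀)
    (i₂ := -i₂ + n) (by omega) (by omega) (by omega) (by omega) (by omega) (by omega) (by omega)
  rw [h.mirror.periodic, h.mirror.periodic] at this
  simp only [cw_mirror, neg_neg] at this
  rw [← cw_rotate (V i₂), ← cw_rotate (V i₂)] at this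
  apply this
  rwa [← cw_rotate (V o₂), ← cw_rotate (V o₂)]

/-- This serves the case that a single exchange cannot settle, where `a₁` is the root and has to
stay. The condition `hne` excludes the comparison of a triangle with itself. -/
theorem lt_of_isMaxAll (h : IsCyclicConvex n V) {t₀ t₁ t₂ a₀ a₁ a₂ : ℤ} (hT : IsMaxAll V t₀ t₁ t₂)
    (h1 : t₀ < t₁) (h2 : t₁ < a₁) (h3 : a₁ < a₂) (h4 : a₂ ≤ t₂) (h5 : t₂ ≤ a₀) (h6 : a₀ ≤ t₀ + n)
    (h7 : t₂ < t₀ + n) (hne : a₂ < t₂ ∨ a₀ < t₀ + n) :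
    cw (V a₀) (V a₁) (V a₂) < cw (V t₀) (V a₁) (V t₂) := by
  refine cw_lt_of_max (h.pos h1 (by omega) h7) (h.pos (by omega) (by omega) (by omega))
    (h.pos (by omega) (by omega) (by omega)) (h.nonneg (by omega) (by omega) (by omega))
    (h.nonneg (by omega) (by omega) (by omega)) (h.pos (by omega) (by omega) (by omega))
    (h.nonneg (by omega) (by omega) (by omega)) ?_ (hT _ _ _) (hT _ _ _) (hT _ _ _) (hT _ _ _) ?_
  · rw [← h.periodic t₀]
    exact h.nonneg (by omega) (by omega) (by omega)
  · rcases hne with hne | hne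
    · exact Or.inl (h.pos (by omega) (by omega) (by omega))
    · exact Or.inr (h.pos (by omega) (by omega) (by omega))

theorem lt_of_isMaxAll' (h : IsCyclicConvex n V) {o₀ o₁ o₂ i₀ i₁ i₂ : ℤ} (hO : IsMaxAll V o₀ o₁ o₂)
    (h1 : o₀ < i₀) (h2 : i₀ < i₁) (h3 : i₁ < o₁) (h4 : o₁ < o₂) (h5 : o₂ ≤ i₂) (h6 : i₂ ≤ o₀ + n)
    (h7 : o₂ < o₀ + n) : cw (V i₀) (V i₁) (V i₂) < cw (V o₀) (V i₁) (V o₂) := by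
  have := h.mirror.lt_of_isMaxAll (t₀ := -o₂) (t₁ := -o₁) (t₂ := -o₀) (a₀ := -i₂ + n) (a₁ := -i₁)
    (a₂ := -i₀) (fun a b c => by simpa only [cw_mirror, neg_neg] using hO (-c) (-b) (-a))
    (by omega) (by omega) (by omega) (by omega) (by omega) (by omega) (by omega) (by omega)
  rw [h.mirror.periodic] at this
  simpa only [cw_mirror, neg_neg] using this

end IsCyclicConvex

/-! ### Optimality under cyclic relabelling and reflection -/

section Rotation

variable {n : ℤ} {V : ℤ → Pt} {i j k : ℤ}

theorem IsMaxAll.rotate (hV : ∀ i, V (i + n) = V i) (h : IsMaxAll V i j k) :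
    IsMaxAll V j k (i + n) := by
  intro a b c
  rw [hV, cw_rotate (V i)]
  exact h a b c

theorem IsMaxRooted.rotate (hV : ∀ i, V (i + n) = V i) (h : IsMaxRooted V i j k) :
    IsMaxRooted V j k (i + n) := by
  simp only [IsMaxRooted, IsMaxThrough, hV, cw_rotate (V i)] at h ⊢
  tauto

theorem IsMaxAll.rotate' (hV : ∀ i, V (i - n) = V i) (h : IsMaxAll V i j k) :
    IsMaxAll V (k - n) i j := by
  intro a b c
  rw [hV, ← cw_rotate (V k)]
  exact h a b c

theorem IsMaxRooted.rotate' (hV : ∀ i, V (i - n) = V i) (h : IsMaxRooted V i j k) :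
    IsMaxRooted V (k - n) i j := by
  simp only [IsMaxRooted, IsMaxThrough, hV, ← cw_rotate (V k) (V i)] at h ⊢
  tauto

/-- Reflection reverses the order; listing the image from `-j` makes the arc between `i` and `j`
come first again, as the arguments on nested arcs require. -/
theorem IsMaxAll.mirror (hV : ∀ i, V (i + n) = V i) (h : IsMaxAll V i j k) :
    IsMaxAll (mirror V) (-j) (-i) (-k + n) := by
  intro a b c
  have : V (-(-k + n)) = V k := by rw [← hV, neg_add, neg_neg, neg_add_cancel_right]
  rw [cw_mirror, cw_mirror, this, neg_neg, neg_neg, ← cw_rotate (V k)]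
  exact h _ _ _

theorem IsMaxThrough.mirror {r : ℤ} (hV : ∀ i, V (i + n) = V i) (h : IsMaxThrough V r i j k) :
    IsMaxThrough (mirror V) (-r) (-j) (-i) (-k + n) := by
  intro b c
  have : V (-(-k + n)) = V k := by rw [← hV, neg_add, neg_neg, neg_add_cancel_right]
  rw [cw_mirror, cw_mirror, this, neg_neg, neg_neg, neg_neg, ← cw_rotate (V k), cw_rotate (V r)]
  exact h _ _

theorem IsMaxRooted.mirror (hV : ∀ i, V (i + n) = V i) (h : IsMaxRooted V i j k) :
    IsMaxRooted (mirror V) (-j) (-i) (-k + n) := by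
  rcases h with h | h | h
  · exact Or.inr (Or.inl (h.mirror hV))
  · exact Or.inl (h.mirror hV)
  · refine Or.inr (Or.inr fun b c => ?_)
    have := h.mirror hV b c
    have e : InscribedTriangle.mirror V (-k + n) = InscribedTriangle.mirror V (-k) := by
      have : V (-(-k + n)) = V k := by rw [← hV, neg_add, neg_neg, neg_add_cancel_right]
      simp only [InscribedTriangle.mirror, this, neg_neg]
    rw [e] at this ⊢
    exact this

end Rotation

/-! ### Excluding an arc strictly inside an arc -/

namespace IsCyclicConvex

variable {n : ℤ} {V : ℤ → Pt} {o₀ o₁ o₂ i₀ i₁ i₂ : ℤ}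

/-- Exchanging `o₁` and `i₁` is admissible unless one of them is the root. If `o₁` is, the larger
triangle `i₀ o₁ i₂` contradicts it; if `i₁` is, the larger triangle `o₀ i₁ o₂` does. -/
theorem not_isMaxPair_right (h : IsCyclicConvex n V) (h1 : o₀ < i₀) (h2 : i₀ < i₁)
    (h3 : i₁ < o₁) (h4 : o₁ < o₂) (h5 : o₂ ≤ i₂) (h6 : i₂ ≤ o₀ + n) (h7 : o₂ < o₀ + n) :
    ¬ IsMaxPair V o₀ o₁ o₂ i₀ i₁ i₂ := by
  have ex := h.exchange h1 h2 h3 h4 h5 (by omega) h7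
  rintro (⟨hO | hO | hO, hI⟩ | ⟨hO, hI | hI | hI⟩)
  · exact (ex (hO _ _)).not_ge (hI _ _ _)
  · have := h.lt_of_isMaxAll (a₀ := o₀ + n) hI h2 h3 h4 h5 h6 (by omega) (by omega) (by omega)
    rw [h.periodic] at this
    have := hO i₂ i₀
    rw [cw_rotate] at this
    linarith
  · refine (ex ?_).not_ge (hI _ _ _)
    rw [← cw_rotate, ← cw_rotate]
    exact hO _ _
  · exact (ex (hO _ _ _)).not_ge (hI _ _)
  · have := h.lt_of_isMaxAll' hO h1 h2 h3 h4 h5 h6 h7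
    have := hI o₂ o₀
    rw [cw_rotate] at this
    linarith
  · refine (ex (hO _ _ _)).not_ge ?_
    rw [← cw_rotate, ← cw_rotate]
    exact hI _ _

theorem not_isMaxPair_left (h : IsCyclicConvex n V) (h1 : o₀ < i₀) (h2 : i₀ < i₁)
    (h3 : i₁ < o₁) (h4 : o₁ < o₂) (h5 : o₁ ≤ i₂) (h6 : i₂ ≤ o₂) (h7 : o₂ < o₀ + n) :
    ¬ IsMaxPair V o₀ o₁ o₂ i₀ i₁ i₂ := by
  intro hp
  refine h.mirror.not_isMaxPair_right (o₀ := -o₁) (o₁ := -o₀) (o₂ := -o₂ + n) (i₀ := -i₁)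
    (i₁ := -i₀) (i₂ := -i₂ + n) (by omega) (by omega) (by omega) (by omega) (by omega) (by omega)
    (by omega) ?_
  exact hp.imp (fun hp => ⟨hp.1.mirror h.periodic, hp.2.mirror h.periodic⟩)
    (fun hp => ⟨hp.1.mirror h.periodic, hp.2.mirror h.periodic⟩)

/-- Two exchanges are available, of `i₂` with `o₁` and of `i₀` with `o₀`. They involve disjoint
vertices, so one of them leaves the root alone. -/
theorem not_isMaxPair_nested (h : IsCyclicConvex n V) (h1 : o₀ < i₀) (h2 : i₀ < i₁)
    (h3 : i₁ < i₂) (h4 : i₂ < o₁) (h5 : o₁ < o₂) (h6 : o₂ < o₀ + n) :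
    ¬ IsMaxPair V o₀ o₁ o₂ i₀ i₁ i₂ := by
  have ex := h.exchange (i₀ := i₁) (i₁ := i₂) (i₂ := i₀ + n) (by omega) h3 h4 h5 (by omega)
    (by omega) h6
  have ex' := h.exchange' h1 h2 (h3.trans h4) h6 (by omega) h3 h5
  rw [h.periodic, cw_rotate (V i₀)] at ex
  rintro (⟨hO | hO | hO, hI⟩ | ⟨hO, hI | hI | hI⟩)
  · exact (ex (hO _ _)).not_ge (hI _ _ _)
  · refine (ex' ?_).not_ge (hI _ _ _)
    rw [← cw_rotate]
    exact hO _ _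
  · refine (ex ?_).not_ge (hI _ _ _)
    rw [← cw_rotate, ← cw_rotate]
    exact hO _ _
  · refine (ex (hO _ _ _)).not_ge ?_
    rw [← cw_rotate, ← cw_rotate]
    exact hI _ _
  · exact (ex (hO _ _ _)).not_ge (hI _ _)
  · refine (ex' (hO _ _ _)).not_ge ?_
    rw [← cw_rotate, ← cw_rotate]
    exact hI _ _

/-- If an arc of the inner triangle lies strictly inside an arc of the outer one, the two triangles
are not both optimal. -/
theorem not_isMaxPair (h : IsCyclicConvex n V) (h1 : o₀ < i₀) (h2 : i₀ < i₁) (h3 : i₁ < o₁)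
    (h4 : o₁ < o₂) (h5 : o₂ < o₀ + n) (h6 : i₁ < i₂) (h7 : i₂ < i₀ + n) :
    ¬ IsMaxPair V o₀ o₁ o₂ i₀ i₁ i₂ := by
  rcases lt_or_ge i₂ o₁ with hc | hc
  · exact h.not_isMaxPair_nested h1 h2 h6 hc h4 h5
  rcases le_or_gt i₂ o₂ with hc' | hc'
  · exact h.not_isMaxPair_left h1 h2 h3 h4 hc hc' h5
  rcases le_or_gt i₂ (o₀ + n) with hd | hd
  · exact h.not_isMaxPair_right h1 h2 h3 h4 hc'.le hd h5
  -- Shifted back by one period, `i₂` lies in the outer arc before `i₀`, so the inner triangle is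
  -- nested.
  · intro hp
    refine h.not_isMaxPair_nested (i₀ := i₂ - n) (i₁ := i₀) (i₂ := i₁) (by omega) (by omega) h2
      h3 h4 h5 ?_
    exact hp.imp (fun hp => ⟨hp.1, hp.2.rotate' h.periodic_sub⟩)
      (fun hp => ⟨hp.1, hp.2.rotate' h.periodic_sub⟩)

end IsCyclicConvex

/-! ### Optimal triangles interleave -/

theorem IsMaxPair.symm {V : ℤ → Pt} {o₀ o₁ o₂ i₀ i₁ i₂ : ℤ} (h : IsMaxPair V o₀ o₁ o₂ i₀ i₁ i₂) :
    IsMaxPair V i₀ i₁ i₂ o₀ o₁ o₂ :=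
  (Or.symm h).imp And.symm And.symm

namespace IsCyclicConvex

variable {n : ℤ} {V : ℤ → Pt}

theorem rotate_isMaxPair (h : IsCyclicConvex n V) {o₀ o₁ o₂ i₀ i₁ i₂ : ℤ}
    (hp : IsMaxPair V o₀ o₁ o₂ i₀ i₁ i₂) : IsMaxPair V o₁ o₂ (o₀ + n) i₀ i₁ i₂ :=
  hp.imp (And.imp_left (·.rotate h.periodic)) (And.imp_left (·.rotate h.periodic))

theorem rotate_isMaxPair' (h : IsCyclicConvex n V) {o₀ o₁ o₂ i₀ i₁ i₂ : ℤ}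
    (hp : IsMaxPair V o₀ o₁ o₂ i₀ i₁ i₂) : IsMaxPair V (o₂ - n) o₀ o₁ i₀ i₁ i₂ :=
  hp.imp (And.imp_left (·.rotate' h.periodic_sub)) (And.imp_left (·.rotate' h.periodic_sub))

/-- The last two hypotheses place the arc between `v₂ - n` and `v₀ + n`. An arc free of all `v`s
would lie strictly inside one of the four gaps there, each an arc of the other triangle up to
rotation. -/
theorem exists_mem_arc (h : IsCyclicConvex n V) {u₀ u₁ u₂ v₀ v₁ v₂ : ℤ}
    (hp : IsMaxPair V v₀ v₁ v₂ u₀ u₁ u₂) (hu₁ : u₀ < u₁) (hu₂ : u₁ < u₂) (hu : u₂ < u₀ + n)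
    (hv₁ : v₀ < v₁) (hv₂ : v₁ < v₂) (hv : v₂ < v₀ + n) (h1 : u₁ < v₀ + n) (h2 : v₂ - n < u₀) :
    u₀ ≤ v₀ ∧ v₀ ≤ u₁ ∨ u₀ ≤ v₁ ∧ v₁ ≤ u₁ ∨ u₀ ≤ v₂ ∧ v₂ ≤ u₁ := by
  by_contra hc
  rcases lt_or_ge u₁ v₀ with c0 | c0
  · exact h.not_isMaxPair h2 hu₁ c0 hv₁ (by omega) hu₂ hu (h.rotate_isMaxPair' hp)
  rcases lt_or_ge u₁ v₁ with c1 | c1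
  · exact h.not_isMaxPair (by omega) hu₁ c1 hv₂ hv hu₂ hu hp
  rcases lt_or_ge u₁ v₂ with c2 | c2
  · exact h.not_isMaxPair (by omega) hu₁ c2 hv (by omega) hu₂ hu (h.rotate_isMaxPair hp)
  · exact h.not_isMaxPair (by omega) hu₁ h1 (by omega) (by omega) hu₂ hu
      (h.rotate_isMaxPair (h.rotate_isMaxPair hp))

theorem separates (h : IsCyclicConvex n V) {u₀ u₁ u₂ v₀ v₁ v₂ : ℕ}
    (hp : IsMaxPair V v₀ v₁ v₂ u₀ u₁ u₂) (hu₁ : u₀ < u₁) (hu₂ : u₁ < u₂) (hu : u₂ < n)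
    (hv₁ : v₀ < v₁) (hv₂ : v₁ < v₂) (hv : v₂ < n) : Separates [v₀, v₁, v₂] [u₀, u₁, u₂] := by
  have hp1 := (h.rotate_isMaxPair hp.symm).symm
  have hp2 := (h.rotate_isMaxPair hp1.symm).symm
  have k0 := h.exists_mem_arc hp (by omega) (by omega) (by omega) (by omega) (by omega) (by omega)
    (by omega) (by omega)
  have k1 := h.exists_mem_arc hp1 (by omega) (by omega) (by omega) (by omega) (by omega) (by omega)
    (by omega) (by omega)
  simp only [Separates, List.getD_cons_zero, List.getD_cons_succ, List.mem_cons, List.not_mem_nil,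
    or_false, exists_eq_or_imp, exists_eq_left]
  refine ⟨by omega, by omega, ?_⟩
  -- The third arc wraps around. Its negated conclusion supplies the position hypothesis `u₀ + n <
  -- v₀ + n` that `exists_mem_arc` needs.
  by_contra hc
  have k2 := h.exists_mem_arc hp2 (by omega) (by omega) (by omega) (by omega) (by omega) (by omega)
    (by omega) (by omega)
  omega

/-- A largest triangle interleaves with every triangle that is largest for one of its vertices. -/
theorem interleave (h : IsCyclicConvex n V) {u₀ u₁ u₂ v₀ v₁ v₂ : ℕ}
    (hr : IsMaxRooted V u₀ u₁ u₂) (ha : IsMaxAll V v₀ v₁ v₂) (hu₁ : u₀ < u₁) (hu₂ : u₁ < u₂)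
    (hu : u₂ < n) (hv₁ : v₀ < v₁) (hv₂ : v₁ < v₂) (hv : v₂ < n) :
    Interleave [u₀, u₁, u₂] [v₀, v₁, v₂] :=
  ⟨h.separates (Or.inr ⟨ha, hr⟩) hu₁ hu₂ hu hv₁ hv₂ hv,
    h.separates (Or.inl ⟨hr, ha⟩) hv₁ hv₂ hv hu₁ hu₂ hu⟩

end IsCyclicConvex

/-- Two increasing triples interleave iff they alternate. -/
theorem interleave_iff {u₀ u₁ u₂ v₀ v₁ v₂ : ℕ} (hu₁ : u₀ < u₁) (hu₂ : u₁ < u₂)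
    (hv₁ : v₀ < v₁) (hv₂ : v₁ < v₂) :
    Interleave [u₀, u₁, u₂] [v₀, v₁, v₂] ↔
      u₀ ≤ v₀ ∧ v₀ ≤ u₁ ∧ u₁ ≤ v₁ ∧ v₁ ≤ u₂ ∧ u₂ ≤ v₂ ∨
      v₀ ≤ u₀ ∧ u₀ ≤ v₁ ∧ v₁ ≤ u₁ ∧ u₁ ≤ v₂ ∧ v₂ ≤ u₂ := by
  simp only [Interleave, Separates, List.getD_cons_zero, List.getD_cons_succ, List.mem_cons,
    List.not_mem_nil, or_false, exists_eq_or_imp, exists_eq_left]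
  constructor
  · rintro ⟨⟨h1, h2, h3⟩, h4, h5, h6⟩
    rcases h1 with h1 | h1 | h1 <;> rcases h2 with h2 | h2 | h2 <;> omega
  · rintro (h | h) <;> omega

/-! ### The two candidate subpolygons -/

theorem insertionSort_eq_of_perm {l l' : List ℕ} (hp : l.Perm l') (hl : l'.Pairwise (· ≤ ·)) :
    l.insertionSort (· ≤ ·) = l' :=
  List.Perm.eq_of_pairwise' (List.pairwise_insertionSort _ _) hl
    ((List.perm_insertionSort _ l).trans hp)

/-- `{x, y} = {a, m}` as multisets. -/
def IsPair (a m x y : ℕ) : Prop := x = a ∧ y = m ∨ x = m ∧ y = a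

/-- The offset `i` belongs to the first candidate. -/
def KeepFirst (X : ℕ → ℕ) (i : ℕ) : Prop :=
  X 0 ≤ i ∧ i ≤ X 1 ∨ X 2 ≤ i ∧ i ≤ X 3 ∨ X 4 ≤ i ∧ i ≤ X 5

/-- The offset `i` belongs to the second candidate. -/
def KeepSecond (X : ℕ → ℕ) (i : ℕ) : Prop :=
  X 1 ≤ i ∧ i ≤ X 2 ∨ X 3 ≤ i ∧ i ≤ X 4 ∨ X 5 ≤ i ∨ i ≤ X 0

/-- The criterion for the first candidate. -/
def FirstMixed (u v : List ℕ) (X : ℕ → ℕ) : Prop :=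
  Mixed u v (X 1) (X 2) ∧ Mixed u v (X 3) (X 4) ∧ Mixed u v (X 5) (X 0)

/-- The sequence `X` is increasing in the range that matters. -/
def Increasing (X : ℕ → ℕ) : Prop :=
  X 0 ≤ X 1 ∧ X 1 ≤ X 2 ∧ X 2 ≤ X 3 ∧ X 3 ≤ X 4 ∧ X 4 ≤ X 5

/-- The merged sequence `X` of two triples, paired so that each of the arcs `[X 1, X 2]`,
`[X 3, X 4]`, `[X 5, X 0]` lies between two pairs. -/
def EvenPattern (a₀ a₁ a₂ m₀ m₁ m₂ : ℕ) (X : ℕ → ℕ) : Prop :=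
  IsPair a₀ m₀ (X 0) (X 1) ∧ IsPair a₁ m₁ (X 2) (X 3) ∧ IsPair a₂ m₂ (X 4) (X 5)

/-- The merged sequence `X` of two triples, paired so that each of the arcs `[X 0, X 1]`,
`[X 2, X 3]`, `[X 4, X 5]` lies between two pairs. -/
def OddPattern (a₀ a₁ a₂ m₀ m₁ m₂ : ℕ) (X : ℕ → ℕ) : Prop :=
  (X 0 = a₀ ∧ X 5 = m₂) ∧ IsPair a₁ m₀ (X 1) (X 2) ∧ IsPair a₂ m₁ (X 3) (X 4) ∨
    (X 0 = m₀ ∧ X 5 = a₂) ∧ IsPair a₀ m₁ (X 1) (X 2) ∧ IsPair a₁ m₂ (X 3) (X 4)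

theorem exists_isPair (a m : ℕ) : ∃ x y, IsPair a m x y ∧ x ≤ y := by
  rcases le_total a m with h | h
  · exact ⟨a, m, Or.inl ⟨rfl, rfl⟩, h⟩
  · exact ⟨m, a, Or.inr ⟨rfl, rfl⟩, h⟩

theorem IsPair.perm {a m x y : ℕ} (h : IsPair a m x y) : List.Perm [a, m] [x, y] := by
  rcases h with ⟨rfl, rfl⟩ | ⟨rfl, rfl⟩
  · exact List.Perm.refl _
  · exact List.Perm.swap _ _ _

/-- Each of the two triples starts either before or after `t₀`. If both start on the same side,
equal indices pair up (even pattern); if not, the indices are shifted by one and the extreme offsets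
form the pair across the origin (odd pattern). -/
theorem exists_pattern {a₀ a₁ a₂ m₀ m₁ m₂ t₀ t₁ t₂ : ℕ} (ha₁ : a₀ < a₁) (ha₂ : a₁ < a₂)
    (hm₁ : m₀ < m₁) (hm₂ : m₁ < m₂) (ht₁ : t₀ < t₁) (ht₂ : t₁ < t₂)
    (hA : Interleave [a₀, a₁, a₂] [t₀, t₁, t₂]) (hM : Interleave [m₀, m₁, m₂] [t₀, t₁, t₂])
    {X : ℕ → ℕ} (hX : X = fun i =>
      (List.insertionSort (· ≤ ·) ([a₀, a₁, a₂] ++ [m₀, m₁, m₂])).getD i 0) :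
    Increasing X ∧
      (EvenPattern a₀ a₁ a₂ m₀ m₁ m₂ X ∧ KeepSecond X t₀ ∧ KeepSecond X t₁ ∧ KeepSecond X t₂ ∨
        OddPattern a₀ a₁ a₂ m₀ m₁ m₂ X ∧ KeepFirst X t₀ ∧ KeepFirst X t₁ ∧ KeepFirst X t₂) := by
  have key : ∀ {x₀ x₁ x₂ x₃ x₄ x₅ : ℕ},
      List.Perm ([a₀, a₁, a₂] ++ [m₀, m₁, m₂]) [x₀, x₁, x₂, x₃, x₄, x₅] →
      (x₀ ≤ x₁ ∧ x₁ ≤ x₂ ∧ x₂ ≤ x₃ ∧ x₃ ≤ x₄ ∧ x₄ ≤ x₅) →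
      X 0 = x₀ ∧ X 1 = x₁ ∧ X 2 = x₂ ∧ X 3 = x₃ ∧ X 4 = x₄ ∧ X 5 = x₅ := by
    intro x₀ x₁ x₂ x₃ x₄ x₅ hp hs
    have := insertionSort_eq_of_perm hp (by
      simp only [List.pairwise_cons, List.mem_cons, List.not_mem_nil, or_false, forall_eq_or_imp,
        forall_eq, false_imp_iff, implies_true, List.Pairwise.nil, and_true]
      omega)
    simp only [hX, this]
    simp
  rw [interleave_iff ha₁ ha₂ ht₁ ht₂] at hA
  rw [interleave_iff hm₁ hm₂ ht₁ ht₂] at hM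
  have even : (∃ x₀ x₁ x₂ x₃ x₄ x₅ : ℕ, IsPair a₀ m₀ x₀ x₁ ∧ IsPair a₁ m₁ x₂ x₃ ∧
      IsPair a₂ m₂ x₄ x₅ ∧ (x₀ ≤ x₁ ∧ x₁ ≤ x₂ ∧ x₂ ≤ x₃ ∧ x₃ ≤ x₄ ∧ x₄ ≤ x₅) ∧
      (x₁ ≤ t₀ ∧ t₀ ≤ x₂ ∧ x₃ ≤ t₁ ∧ t₁ ≤ x₄ ∧ x₅ ≤ t₂ ∨
        t₀ ≤ x₀ ∧ x₁ ≤ t₁ ∧ t₁ ≤ x₂ ∧ x₃ ≤ t₂ ∧ t₂ ≤ x₄)) →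
      Increasing X ∧ EvenPattern a₀ a₁ a₂ m₀ m₁ m₂ X ∧
        KeepSecond X t₀ ∧ KeepSecond X t₁ ∧ KeepSecond X t₂ := by
    rintro ⟨x₀, x₁, x₂, x₃, x₄, x₅, p, q, r, hs, ht⟩
    have perm : List.Perm ([a₀, a₁, a₂] ++ [m₀, m₁, m₂]) ([a₀, m₀] ++ ([a₁, m₁] ++ [a₂, m₂])) := by
      rw [← Multiset.coe_eq_coe]
      simp only [List.cons_append, List.nil_append, ← Multiset.cons_coe, Multiset.coe_nil]
      simp only [← Multiset.singleton_add]
      abel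
    obtain ⟨e0, e1, e2, e3, e4, e5⟩ :=
      key (perm.trans (p.perm.append (q.perm.append r.perm))) hs
    simp only [Increasing, EvenPattern, KeepSecond, e0, e1, e2, e3, e4, e5]
    exact ⟨hs, ⟨p, q, r⟩, by omega, by omega, by omega⟩
  have odd : ∀ {b₀ b₁ b₂ c₀ c₁ c₂ : ℕ},
      List.Perm ([a₀, a₁, a₂] ++ [m₀, m₁, m₂]) ([b₀] ++ ([b₁, c₀] ++ ([b₂, c₁] ++ [c₂]))) →
      (b₀ ≤ t₀ ∧ t₀ ≤ b₁ ∧ t₀ ≤ c₀ ∧ b₁ ≤ t₁ ∧ c₀ ≤ t₁ ∧ t₁ ≤ b₂ ∧ t₁ ≤ c₁ ∧ b₂ ≤ t₂ ∧ c₁ ≤ t₂ ∧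
        t₂ ≤ c₂) →
      Increasing X ∧ ((X 0 = b₀ ∧ X 5 = c₂) ∧ IsPair b₁ c₀ (X 1) (X 2) ∧
        IsPair b₂ c₁ (X 3) (X 4)) ∧ KeepFirst X t₀ ∧ KeepFirst X t₁ ∧ KeepFirst X t₂ := by
    intro b₀ b₁ b₂ c₀ c₁ c₂ perm ht
    obtain ⟨x₁, x₂, p, hp⟩ := exists_isPair b₁ c₀
    obtain ⟨x₃, x₄, q, hq⟩ := exists_isPair b₂ c₁
    obtain ⟨e0, e1, e2, e3, e4, e5⟩ :=
      key (perm.trans ((List.Perm.refl _).append (p.perm.append (q.perm.append (List.Perm.refl _)))))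
        (by rcases p with p | p <;> rcases q with q | q <;> omega)
    simp only [Increasing, KeepFirst, e0, e1, e2, e3, e4, e5]
    refine ⟨?_, ⟨⟨trivial, trivial⟩, p, q⟩, ?_⟩ <;> rcases p with p | p <;> rcases q with q | q <;> omega
  obtain ⟨x₀, x₁, p, hp⟩ := exists_isPair a₀ m₀
  obtain ⟨x₂, x₃, q, hq⟩ := exists_isPair a₁ m₁
  obtain ⟨x₄, x₅, r, hr⟩ := exists_isPair a₂ m₂
  rcases hA with hA | hA <;> rcases hM with hM | hM
  · obtain ⟨h1, h2⟩ := even ⟨x₀, x₁, x₂, x₃, x₄, x₅, p, q, r, by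
      rcases p with p | p <;> rcases q with q | q <;> rcases r with r | r <;> omega⟩
    exact ⟨h1, Or.inl h2⟩
  · obtain ⟨h1, h2⟩ := odd (b₀ := a₀) (b₁ := a₁) (b₂ := a₂) (c₀ := m₀) (c₁ := m₁) (c₂ := m₂) (by
      rw [← Multiset.coe_eq_coe]
      simp only [List.cons_append, List.nil_append, ← Multiset.cons_coe, Multiset.coe_nil]
      simp only [← Multiset.singleton_add]
      abel) (by omega)
    exact ⟨h1, Or.inr ⟨Or.inl h2.1, h2.2⟩⟩
  · obtain ⟨h1, h2⟩ := odd (b₀ := m₀) (b₁ := a₀) (b₂ := a₁) (c₀ := m₁) (c₁ := m₂) (c₂ := a₂) (by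
      rw [← Multiset.coe_eq_coe]
      simp only [List.cons_append, List.nil_append, ← Multiset.cons_coe, Multiset.coe_nil]
      simp only [← Multiset.singleton_add]
      abel) (by omega)
    exact ⟨h1, Or.inr ⟨Or.inr h2.1, h2.2⟩⟩
  · obtain ⟨h1, h2⟩ := even ⟨x₀, x₁, x₂, x₃, x₄, x₅, p, q, r, by
      rcases p with p | p <;> rcases q with q | q <;> rcases r with r | r <;> omega⟩
    exact ⟨h1, Or.inl h2⟩

/-! ### Choice of the candidate, and the gap beside the median -/

section Pattern

variable {a₀ a₁ a₂ m₀ m₁ m₂ : ℕ} {X : ℕ → ℕ}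

theorem OddPattern.firstMixed (h : OddPattern a₀ a₁ a₂ m₀ m₁ m₂ X) :
    FirstMixed [a₀, a₁, a₂] [m₀, m₁, m₂] X := by
  simp only [OddPattern, IsPair, FirstMixed, Mixed, List.mem_cons, List.not_mem_nil,
    or_false] at *
  omega

/-- Mixing in the even pattern forces all three pairs to be ordered alike. With
`OddPattern.firstMixed` this makes the test decisive when the dividing triangles do not interleave.
-/
theorem EvenPattern.interleave (hX : Increasing X) (h : EvenPattern a₀ a₁ a₂ m₀ m₁ m₂ X)
    (ha₁ : a₀ < a₁) (ha₂ : a₁ < a₂) (hm₁ : m₀ < m₁) (hm₂ : m₁ < m₂)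
    (hf : FirstMixed [a₀, a₁, a₂] [m₀, m₁, m₂] X) : Interleave [a₀, a₁, a₂] [m₀, m₁, m₂] := by
  rw [interleave_iff ha₁ ha₂ hm₁ hm₂]
  simp only [EvenPattern, IsPair, Increasing, FirstMixed, Mixed, List.mem_cons, List.not_mem_nil,
    or_false] at *
  obtain ⟨p, q, r⟩ := h
  obtain ⟨⟨f1, f2⟩, ⟨f3, f4⟩, f5, f6⟩ := hf
  rcases p with p | p <;> rcases q with q | q <;> rcases r with r | r <;> omega

/-- If the triples alternate, then so do the members of the merged sequence. -/
theorem alternating_of_interleave (hX : Increasing X)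
    (h : EvenPattern a₀ a₁ a₂ m₀ m₁ m₂ X ∨ OddPattern a₀ a₁ a₂ m₀ m₁ m₂ X)
    (ha₁ : a₀ < a₁) (ha₂ : a₁ < a₂) (hm₁ : m₀ < m₁) (hm₂ : m₁ < m₂)
    (hI : Interleave [a₀, a₁, a₂] [m₀, m₁, m₂]) :
    (X 0 = a₀ ∧ X 1 = m₀ ∧ X 2 = a₁ ∧ X 3 = m₁ ∧ X 4 = a₂ ∧ X 5 = m₂) ∨
      (X 0 = m₀ ∧ X 1 = a₀ ∧ X 2 = m₁ ∧ X 3 = a₁ ∧ X 4 = m₂ ∧ X 5 = a₂) := by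
  rw [interleave_iff ha₁ ha₂ hm₁ hm₂] at hI
  simp only [EvenPattern, OddPattern, IsPair, Increasing] at *
  rcases h with ⟨p, q, r⟩ | ⟨⟨h1, h2⟩, p, q⟩ | ⟨⟨h1, h2⟩, p, q⟩
  · rcases p with p | p <;> rcases q with q | q <;> rcases r with r | r <;> omega
  · rcases p with p | p <;> rcases q with q | q <;> omega
  · rcases p with p | p <;> rcases q with q | q <;> omega

/-- One of the two gaps of length `h` next to `m` contains no offset in `keep`. -/
def AvoidsGap (m h : ℕ) (keep : ℕ → Prop) : Prop :=
  (∀ i, m < i + h → i < m → ¬ keep i) ∨ (∀ i, m < i → i < m + h → ¬ keep i)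

/-- One of the two gaps of length `h` next to `m` lies entirely in `keep`. -/
def CoversGap (m h : ℕ) (keep : ℕ → Prop) : Prop :=
  (∀ i, m ≤ i + h → i < m → keep i) ∨ (∀ i, m < i → i ≤ m + h → keep i)

/-- The number `m` is at distance at least `h` from `x`. -/
def Far (m h x : ℕ) : Prop := x + h ≤ m ∨ m + h ≤ x

variable {m h n : ℕ}

/-- The second candidate omits the open arc between `m` and its partner in the first triple, which
is at distance at least `h`. -/
theorem EvenPattern.avoidsGap (hX : Increasing X) (hp : EvenPattern a₀ a₁ a₂ m₀ m₁ m₂ X)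
    (hm : m = m₀ ∨ m = m₁ ∨ m = m₂) (ha₀ : Far m h a₀) (ha₁ : Far m h a₁) (ha₂ : Far m h a₂) :
    AvoidsGap m h (KeepSecond X) := by
  simp only [EvenPattern, IsPair, Increasing, Far, AvoidsGap, KeepSecond] at *
  obtain ⟨p, q, r⟩ := hp
  rcases hm with rfl | rfl | rfl
  · rcases p with p | p
    · exact Or.inl fun i _ _ => by omega
    · exact Or.inr fun i _ _ => by omega
  · rcases q with p | p
    · exact Or.inl fun i _ _ => by omega
    · exact Or.inr fun i _ _ => by omega
  · rcases r with p | p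
    · exact Or.inl fun i _ _ => by omega
    · exact Or.inr fun i _ _ => by omega

theorem OddPattern.avoidsGap (hX : Increasing X) (hp : OddPattern 0 a₁ a₂ m₀ m₁ m₂ X)
    (hm : m = m₀ ∨ m = m₁ ∨ m = m₂) (hh : 0 < h)
    (ha₀ : Far m h 0) (ha₁ : Far m h a₁) (ha₂ : Far m h a₂) :
    AvoidsGap m h (KeepFirst X) := by
  simp only [OddPattern, IsPair, Increasing, Far, AvoidsGap, KeepFirst] at *
  rcases hp with ⟨h1, p, q⟩ | ⟨h1, p, q⟩
  · rcases hm with rfl | rfl | rfl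
    · rcases p with p | p
      · exact Or.inl fun i _ _ => by omega
      · exact Or.inr fun i _ _ => by omega
    · rcases q with p | p
      · exact Or.inl fun i _ _ => by omega
      · exact Or.inr fun i _ _ => by omega
    · exact Or.inr fun i _ _ => by omega
  · rcases hm with rfl | rfl | rfl
    -- Impossible: here `m = X 0 ≤ 0`, although `m` is at distance at least `h > 0` from the root
    -- offset `0`.
    · omega
    · rcases p with p | p
      · exact Or.inl fun i _ _ => by omega
      · exact Or.inr fun i _ _ => by omega
    · rcases q with p | p
      · exact Or.inl fun i _ _ => by omega
      · exact Or.inr fun i _ _ => by omega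

/-- Both cyclic neighbours of `m` in the merged sequence come from the first triple, and each
candidate takes exactly one of the two arcs at `m`. -/
theorem gaps_of_alternating (hX : Increasing X)
    (hp : (X 0 = 0 ∧ X 1 = m₀ ∧ X 2 = a₁ ∧ X 3 = m₁ ∧ X 4 = a₂ ∧ X 5 = m₂) ∨
      (X 0 = m₀ ∧ X 1 = 0 ∧ X 2 = m₁ ∧ X 3 = a₁ ∧ X 4 = m₂ ∧ X 5 = a₂))
    (hm : m = m₀ ∨ m = m₁ ∨ m = m₂) (hh : 0 < h)
    (ha₀ : Far m h 0) (ha₁ : Far m h a₁) (ha₂ : Far m h a₂) :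
    (AvoidsGap m h (KeepFirst X) ∧ AvoidsGap m h (KeepSecond X)) ∧
      CoversGap m h (KeepFirst X) ∧ CoversGap m h (KeepSecond X) := by
  simp only [Increasing, Far, AvoidsGap, CoversGap, KeepFirst, KeepSecond] at *
  rcases hp with hp | hp
  · refine ⟨⟨Or.inr fun i _ _ => ?_, Or.inl fun i _ _ => ?_⟩, Or.inl fun i _ _ => ?_,
      Or.inr fun i _ _ => ?_⟩ <;> omega
  · refine ⟨⟨Or.inl fun i _ _ => ?_, Or.inr fun i _ _ => ?_⟩, Or.inr fun i _ _ => ?_,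
      Or.inl fun i _ _ => ?_⟩ <;> omega

end Pattern

/-! ### Running times -/

theorem bind_val {α β : Type} (x : Timed α) (f : α → Timed β) : (x >>= f).val = (f x.val).val := rfl

theorem bind_time {α β : Type} (x : Timed α) (f : α → Timed β) :
    (x >>= f).time = x.time + (f x.val).time := rfl

theorem pure_val {α : Type} (a : α) : (pure a : Timed α).val = a := rfl

theorem pure_time {α : Type} (a : α) : (pure a : Timed α).time = 0 := rfl

theorem ops_val {α : Type} (k : ℕ) (a : α) : (ops k a).val = a := rfl

theorem ops_time {α : Type} (k : ℕ) (a : α) : (ops k a).time = k := rfl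

/-! ### Polygons as cyclic sequences -/

/-- The vertices of `P`, indexed cyclically by the integers. -/
def cyc (P : Array Pt) (z : ℤ) : Pt := vtx P (z % (P.size : ℤ)).toNat

theorem cyc_natCast (P : Array Pt) (i : ℕ) : cyc P i = vtx P i := by
  rw [cyc, ← Int.natCast_mod, Int.toNat_natCast, vtx, vtx, Nat.mod_mod]

theorem cyc_add_mul (P : Array Pt) (z q : ℤ) : cyc P (z + P.size * q) = cyc P z := by
  rw [cyc, cyc, Int.add_mul_emod_self_left]

theorem cyc_add_size (P : Array Pt) (z : ℤ) : cyc P (z + P.size) = cyc P z := by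
  simpa using cyc_add_mul P z 1

theorem IsConvexPolygon.size_pos {P : Array Pt} (h : IsConvexPolygon P) : 0 < P.size := by
  have := h.1
  omega

theorem vtx_mem {P : Array Pt} (h : 0 < P.size) (i : ℕ) : vtx P i ∈ P := by
  have : i % P.size < P.size := Nat.mod_lt _ h
  simp [vtx, Array.getD, this]

theorem cyc_mem {P : Array Pt} (h : 0 < P.size) (z : ℤ) : cyc P z ∈ P := vtx_mem h _

theorem exists_cyc_eq {P : Array Pt} {p : Pt} (hp : p ∈ P) (a : ℤ) :
    ∃ i : ℕ, i < P.size ∧ p = cyc P (a + i) := by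
  obtain ⟨j, hj, rfl⟩ := Array.mem_iff_getElem.1 hp
  have hpos : (0 : ℤ) < P.size := by omega
  have h0 := Int.emod_nonneg (j - a) hpos.ne'
  have h1 := Int.emod_lt_of_pos (j - a) hpos
  refine ⟨((j - a) % P.size).toNat, by omega, ?_⟩
  rw [Int.toNat_of_nonneg h0, Int.emod_def]
  have : a + (j - a - P.size * ((j - a) / P.size)) = j + P.size * -((j - a) / P.size) := by ring
  rw [this, cyc_add_mul, cyc_natCast, vtx, Nat.mod_eq_of_lt hj]
  simp [Array.getD, hj]

theorem IsConvexPolygon.isCyclicConvex {P : Array Pt} (h : IsConvexPolygon P) :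
    IsCyclicConvex P.size (cyc P) where
  periodic := cyc_add_size P
  pos := by
    have hpos : (0 : ℤ) < P.size := by have := h.1; omega
    have key : ∀ i j k : ℤ, 0 ≤ i → i < j → j < k → k < P.size →
        0 < cw (cyc P i) (cyc P j) (cyc P k) := by
      intro i j k h0 hij hjk hk
      lift i to ℕ using h0
      lift j to ℕ using by omega
      lift k to ℕ using by omega
      simp only [cyc_natCast, cw]
      have := h.2 i j k (by omega) (by omega) (by omega)
      linarith
    have red : ∀ i j k : ℤ, 0 ≤ i → i < P.size → i < j → j < k → k < i + P.size →
        0 < cw (cyc P i) (cyc P j) (cyc P k) := by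
      intro i j k h0 hi hij hjk hk
      have e : ∀ z, cyc P z = cyc P (z - P.size) := fun z => by
        rw [← cyc_add_size P (z - P.size), sub_add_cancel]
      rcases lt_or_ge k P.size with hk' | hk'
      · exact key i j k h0 hij hjk hk'
      rw [e k]
      rcases lt_or_ge j P.size with hj' | hj'
      · rw [cw_rotate]
        exact key _ _ _ (by omega) (by omega) hij hj'
      · rw [e j, ← cw_rotate]
        exact key _ _ _ (by omega) (by omega) (by omega) hi
    intro i j k hij hjk hk
    have e : ∀ z, cyc P z = cyc P (z - P.size * (i / P.size)) := fun z => by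
      rw [← cyc_add_mul P z (-(i / P.size))]
      congr 1; ring
    rw [e i, e j, e k]
    have h0 := Int.emod_nonneg i hpos.ne'
    have h1 := Int.emod_lt_of_pos i hpos
    rw [Int.emod_def] at h0 h1
    exact red _ _ _ h0 h1 (by omega) (by omega) (by omega)

/-! ### The sweep -/

/-- The vertices of `P`, indexed cyclically by their offset from `r`. -/
def offs (P : Array Pt) (r : ℕ) (z : ℤ) : Pt := cyc P (r + z)

theorem offs_natCast (P : Array Pt) (r i : ℕ) : offs P r i = vtx P (r + i) := by
  rw [offs, ← Nat.cast_add, cyc_natCast]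

theorem IsConvexPolygon.isCyclicConvex_offs {P : Array Pt} (h : IsConvexPolygon P) (r : ℕ) :
    IsCyclicConvex P.size (offs P r) :=
  h.isCyclicConvex.shift r

/-- Twice the area of the triangle with offsets `0 < b < c` from `r`. -/
def rootedArea (P : Array Pt) (r b c : ℕ) : ℝ := cw (offs P r 0) (offs P r b) (offs P r c)

section Sweep

variable {P : Array Pt} {r b c : ℕ}

theorem area_triAt (h : IsConvexPolygon P) (hbc : b ≤ c) (hc : c ≤ P.size) :
    area (triAt P r b c) = rootedArea P r b c / 2 := by
  have := (h.isCyclicConvex_offs r).nonneg (i := 0) (j := b) (k := c) (by omega) (by omega)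
    (by omega)
  have e := offs_natCast P r 0
  rw [Nat.cast_zero, add_zero] at e
  rw [triAt, area_eq_abs_cw, rootedArea, ← e, ← offs_natCast, ← offs_natCast, abs_of_nonneg this]

theorem rootedArea_up (h : IsConvexPolygon P) {b' : ℕ} (h0 : 0 < b) (hb : b < b') (hb' : b' ≤ c)
    (hc : c + 1 < P.size) (hle : rootedArea P r b c ≤ rootedArea P r b (c + 1)) :
    rootedArea P r b' c ≤ rootedArea P r b' (c + 1) := by
  have hV := h.isCyclicConvex_offs r
  exact (cw_lt_of_base_end (hV.pos (by omega) (by omega) (by omega))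
    (hV.nonneg (by omega) (by omega) (by omega)) (hV.pos (by omega) (by omega) (by omega))
    (hV.pos (by omega) (by omega) (by omega)) hle).le

theorem rootedArea_down (h : IsConvexPolygon P) (h0 : 0 < b) (hb : b < c)
    (hc : c + 2 < P.size) (hlt : rootedArea P r b (c + 1) < rootedArea P r b c) :
    rootedArea P r b (c + 2) < rootedArea P r b (c + 1) := by
  have hV := h.isCyclicConvex_offs r
  exact cw_unimodal (hV.pos (by omega) (by omega) (by omega))
    (hV.pos (by omega) (by omega) (by omega)) (hV.pos (by omega) (by omega) (by omega))
    (hV.pos (by omega) (by omega) (by omega)) hlt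

/-- The area does not decrease while the third vertex moves from `b + 1` to `c`. -/
def Ascending (P : Array Pt) (r b c : ℕ) : Prop :=
  ∀ j, b < j → j < c → rootedArea P r b j ≤ rootedArea P r b (j + 1)

/-- Before `c` the ascent applies. After `c` the first strict decrease propagates by unimodality, so
the local stopping rule finds a global maximum even though steps between equal areas are allowed. -/
theorem Ascending.le (h : IsConvexPolygon P) (h0 : 0 < b) (hbc : b < c)
    (hA : Ascending P r b c)
    (hlast : c + 1 < P.size → rootedArea P r b (c + 1) < rootedArea P r b c) {k : ℕ}
    (hbk : b < k) (hk : k < P.size) : rootedArea P r b k ≤ rootedArea P r b c := by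
  rcases le_total k c with hkc | hkc
  · have : ∀ d, k + d ≤ c → rootedArea P r b k ≤ rootedArea P r b (k + d) := by
      intro d
      induction d with
      | zero => intro _; exact le_rfl
      | succ d ih =>
        intro hd
        exact (ih (by omega)).trans (hA (k + d) (by omega) (by omega))
    have := this (c - k) (by omega)
    rwa [Nat.add_sub_cancel' hkc] at this
  · have : ∀ d, c + d + 1 < P.size →
        rootedArea P r b (c + d + 1) < rootedArea P r b (c + d) ∧
          rootedArea P r b (c + d + 1) ≤ rootedArea P r b c := by
      intro d
      induction d with
      | zero => intro hd; exact ⟨hlast hd, (hlast hd).le⟩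
      | succ d ih =>
        intro hd
        obtain ⟨h1, h2⟩ := ih (by omega)
        have := rootedArea_down (c := c + d) h h0 (by omega) (by omega) h1
        exact ⟨this, this.le.trans h2⟩
    rcases hkc.eq_or_lt with rfl | hkc
    · exact le_rfl
    · have := (this (k - c - 1) (by omega)).2
      rwa [show c + (k - c - 1) + 1 = k by omega] at this

/-- The time bound is amortized: each successful step is charged to the advance of `c`, which is
never undone during the sweep. -/
theorem climb_spec (h : IsConvexPolygon P) (hbc : b < c) (hc : c < P.size)
    (hA : Ascending P r b c) :
    c ≤ (climb P r b c).val ∧ (climb P r b c).val < P.size ∧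
      Ascending P r b (climb P r b c).val ∧
      ((climb P r b c).val + 1 < P.size →
        rootedArea P r b ((climb P r b c).val + 1) < rootedArea P r b (climb P r b c).val) ∧
      (climb P r b c).time + 50 * c ≤ 50 * (climb P r b c).val + 50 := by
  induction hd : P.size - c generalizing c with
  | zero => omega
  | succ d ih =>
    rw [climb]
    split_ifs with hn
    · simp only [bind_val, bind_time, ops_val, ops_time]
      rw [area_triAt h hbc.le hc.le, area_triAt h (by omega) hn.le]
      by_cases hup : rootedArea P r b c / 2 ≤ rootedArea P r b (c + 1) / 2
      · simp only [hup, decide_true, if_true]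
        obtain ⟨h1, h2, h3, h4, h5⟩ := ih (c := c + 1) (by omega) hn (by
          intro j hj hjc
          rcases Nat.lt_succ_iff_lt_or_eq.1 hjc with hjc | rfl
          · exact hA j hj hjc
          · linarith) (by omega)
        exact ⟨by omega, h2, h3, h4, by omega⟩
      · simp only [hup, decide_false, Bool.false_eq_true, if_false, pure_val, pure_time]
        exact ⟨le_rfl, hc, hA, fun _ => by linarith, by omega⟩
    · simp only [ops_val, ops_time]
      exact ⟨le_rfl, hc, hA, fun h => absurd h hn, by omega⟩

theorem sweep_spec (h : IsConvexPolygon P) (h0 : 0 < b) (hc : c < P.size)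
    (hA : Ascending P r b c) {best : ℕ × ℕ}
    (hbest : 0 < best.1 ∧ best.1 < best.2 ∧ best.2 < P.size)
    (hmax : ∀ i k, 0 < i → i < b → i < k → k < P.size →
      rootedArea P r i k ≤ rootedArea P r best.1 best.2) :
    (0 < (sweep P r b c best).val.1 ∧
      (sweep P r b c best).val.1 < (sweep P r b c best).val.2 ∧
      (sweep P r b c best).val.2 < P.size) ∧
    (∀ i k, 0 < i → i < k → k < P.size → rootedArea P r i k ≤
      rootedArea P r (sweep P r b c best).val.1 (sweep P r b c best).val.2) ∧
    (sweep P r b c best).time ≤ 154 * (P.size - b) + 50 * (P.size - c) + 2 := by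
  induction hd : P.size - b generalizing b c best with
  | zero =>
    rw [sweep, dif_neg (by omega)]
    simp only [ops_val, ops_time]
    exact ⟨hbest, fun i k hi hik hk => hmax i k hi (by omega) hik hk, by omega⟩
  | succ d ih =>
    rw [sweep]
    split_ifs with hn
    · simp only [bind_val, bind_time, ops_val, ops_time]
      obtain ⟨h1, h2, h3, h4, h5⟩ := climb_spec (c := max c (b + 1)) h (by omega) (by omega)
        (fun j hj hjc => hA j hj (by omega))
      generalize climb P r b (max c (b + 1)) = C at *
      rw [area_triAt h hbest.2.1.le hbest.2.2.le, area_triAt h (by omega) h2.le]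
      have hC : ∀ k, b < k → k < P.size → rootedArea P r b k ≤ rootedArea P r b C.val :=
        fun k hk hkn => h3.le h h0 (by omega) h4 hk hkn
      -- The invariant of the sweep survives the move of `b`, so no position of `c` that was passed
      -- needs another look.
      have hA' : Ascending P r (b + 1) C.val := fun j hj hjc =>
        rootedArea_up h h0 (by omega) hj.le (by omega) (h3 j (by omega) hjc)
      have fin : ∀ best' : ℕ × ℕ, (0 < best'.1 ∧ best'.1 < best'.2 ∧ best'.2 < P.size) →
          rootedArea P r best.1 best.2 ≤ rootedArea P r best'.1 best'.2 →
          rootedArea P r b C.val ≤ rootedArea P r best'.1 best'.2 → _ :=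
        fun best' hb' hle hle' => ih (b := b + 1) (c := C.val) (best := best') (by omega) h2 hA' hb'
          (fun i k hi hib hik hk => by
            rcases Nat.lt_succ_iff_lt_or_eq.1 hib with hib | rfl
            · exact (hmax i k hi hib hik hk).trans hle
            · exact (hC k hik hk).trans hle') (by omega)
      by_cases hlt : rootedArea P r best.1 best.2 / 2 < rootedArea P r b C.val / 2
      · simp only [hlt, decide_true, if_true]
        obtain ⟨f1, f2, f3⟩ := fin (b, C.val) ⟨h0, by simp only; omega, h2⟩
          (by simp only; linarith) le_rfl
        exact ⟨f1, f2, by omega⟩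
      · simp only [hlt, decide_false, Bool.false_eq_true, if_false]
        obtain ⟨f1, f2, f3⟩ := fin best hbest le_rfl (by linarith)
        exact ⟨f1, f2, by omega⟩
    · simp only [ops_val, ops_time]
      exact ⟨hbest, fun i k hi hik hk => hmax i k hi (by omega) hik hk, by omega⟩

theorem rootedOffsets_spec (h : IsConvexPolygon P) (r : ℕ) :
    (0 < (rootedOffsets P r).val.1 ∧
      (rootedOffsets P r).val.1 < (rootedOffsets P r).val.2 ∧
      (rootedOffsets P r).val.2 < P.size) ∧
    (∀ i k, 0 < i → i < k → k < P.size → rootedArea P r i k ≤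
      rootedArea P r (rootedOffsets P r).val.1 (rootedOffsets P r).val.2) := by
  have := h.1
  obtain ⟨h1, h2, -⟩ := sweep_spec (r := r) (b := 1) (c := 2) (best := (1, 2)) h one_pos (by omega)
    (fun j _ _ => by omega) ⟨one_pos, one_lt_two, by simp only; omega⟩ (fun i k _ _ => by omega)
  exact ⟨h1, h2⟩

theorem rootedOffsets_time (h : IsConvexPolygon P) (r : ℕ) :
    (rootedOffsets P r).time ≤ 204 * P.size := by
  have := h.1
  obtain ⟨-, -, h3⟩ := sweep_spec (r := r) (b := 1) (c := 2) (best := (1, 2)) h one_pos (by omega)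
    (fun j _ _ => by omega) ⟨one_pos, one_lt_two, by simp only; omega⟩ (fun i k _ _ => by omega)
  exact h3.trans (by omega)

end Sweep

/-! ### Rooted and global optima -/

section Optimal

variable {P : Array Pt}

theorem offs_mem (h : 0 < P.size) (r : ℕ) (z : ℤ) : offs P r z ∈ P := cyc_mem h _

theorem exists_offs_eq {p : Pt} (hp : p ∈ P) (a : ℕ) : ∃ i : ℕ, i < P.size ∧ p = offs P a i :=
  exists_cyc_eq hp a

theorem offs_mod (a m : ℕ) (z : ℤ) : offs P ((a + m) % P.size) z = offs P a (m + z) := by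
  rw [offs, offs, cyc, cyc, Int.natCast_mod, Int.emod_add_emod, Nat.cast_add, add_assoc]

theorem abs_cw_le_rootedOffsets (h : IsConvexPolygon P) (r : ℕ) {q s : Pt} (hq : q ∈ P)
    (hs : s ∈ P) : |cw (offs P r 0) q s| ≤
      rootedArea P r (rootedOffsets P r).val.1 (rootedOffsets P r).val.2 := by
  obtain ⟨⟨h1, h2, h3⟩, hmax⟩ := rootedOffsets_spec h r
  have hV := h.isCyclicConvex_offs r
  have h0 : 0 ≤ rootedArea P r (rootedOffsets P r).val.1 (rootedOffsets P r).val.2 :=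
    hV.nonneg (by omega) (by omega) (by omega)
  have key : ∀ i j : ℕ, i < j → j < P.size → |cw (offs P r 0) (offs P r i) (offs P r j)| ≤
      rootedArea P r (rootedOffsets P r).val.1 (rootedOffsets P r).val.2 := by
    intro i j hij hj
    rw [abs_of_nonneg (hV.nonneg (by omega) (by omega) (by omega))]
    rcases Nat.eq_zero_or_pos i with rfl | hi
    · rwa [Nat.cast_zero, cw_self_left]
    · exact hmax i j hi hij hj
  obtain ⟨i, hi, rfl⟩ := exists_offs_eq hq r
  obtain ⟨j, hj, rfl⟩ := exists_offs_eq hs r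
  rcases lt_trichotomy i j with hij | rfl | hij
  · exact key i j hij hj
  · rwa [cw_self_right, abs_zero]
  · rw [cw_swap, abs_neg]
    exact key j i hij hi

theorem offs_zero (r : ℕ) : offs P r 0 = vtx P r := by
  simpa using offs_natCast P r 0

theorem isLargestRooted_rootedTriangle (h : IsConvexPolygon P) (r : ℕ) :
    IsLargestRooted P (vtx P r) (rootedTriangle P r).val := by
  obtain ⟨⟨h1, h2, h3⟩, -⟩ := rootedOffsets_spec h r
  refine ⟨⟨⟨vtx_mem h.size_pos _, vtx_mem h.size_pos _, vtx_mem h.size_pos _⟩, rfl⟩,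
    fun q hq s hs => ?_⟩
  simp only [rootedTriangle, bind_val, ops_val]
  rw [area_triAt h h2.le h3.le, area_eq_abs_cw, ← offs_zero]
  have := abs_cw_le_rootedOffsets h r hq hs
  linarith

theorem isMaxThrough_rootedOffsets (h : IsConvexPolygon P) (r : ℕ) :
    IsMaxThrough (offs P r) 0 0 (rootedOffsets P r).val.1 (rootedOffsets P r).val.2 :=
  fun _ _ => (le_abs_self _).trans
    (abs_cw_le_rootedOffsets h r (offs_mem h.size_pos _ _) (offs_mem h.size_pos _ _))

/-- The second triangle is found relative to its own root. Seen from `a`, none, one or two of its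
other vertices wrap past offset `0`, and each wrap rotates the triple. -/
theorem exists_sorted_rootedOffsets (h : IsConvexPolygon P) (a : ℕ) {m : ℕ} (hm : m < P.size)
    {o : ℕ × ℕ} (ho : o = (rootedOffsets P ((a + m) % P.size)).val) :
    ∃ m₀ m₁ m₂ : ℕ, m₀ < m₁ ∧ m₁ < m₂ ∧ m₂ < P.size ∧ (m = m₀ ∨ m = m₁ ∨ m = m₂) ∧
      List.insertionSort (· ≤ ·) [m, (m + o.1) % P.size, (m + o.2) % P.size] = [m₀, m₁, m₂] ∧
      IsMaxRooted (offs P a) m₀ m₁ m₂ := by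
  obtain ⟨⟨h1, h2, h3⟩, -⟩ := rootedOffsets_spec h ((a + m) % P.size)
  have hmax := isMaxThrough_rootedOffsets h ((a + m) % P.size)
  rw [← ho] at h1 h2 h3 hmax
  obtain ⟨b, c⟩ := o
  simp only at h1 h2 h3 hmax ⊢
  have hV := h.isCyclicConvex_offs a
  have hR : IsMaxRooted (offs P a) m (m + b : ℕ) (m + c : ℕ) := by
    refine Or.inl fun z w => ?_
    have := hmax (z - m) (w - m)
    simpa only [offs_mod, add_zero, add_sub_cancel, ← Nat.cast_add] using this
  have hmod : ∀ x, x < P.size → P.size ≤ m + x → (m + x) % P.size = m + x - P.size := by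
    intro x hx hx'
    rw [Nat.mod_eq_sub_mod hx', Nat.mod_eq_of_lt (by omega)]
  have sorted : ∀ {x y z : ℕ}, x < y → y < z → [x, y, z].Pairwise (· ≤ ·) := by
    intro x y z hxy hyz
    simp only [List.pairwise_cons, List.mem_cons, List.not_mem_nil, or_false, forall_eq_or_imp,
        forall_eq, false_imp_iff, implies_true, List.Pairwise.nil, and_true]
    omega
  rcases lt_or_ge (m + c) P.size with hc | hc
  · refine ⟨m, m + b, m + c, by omega, by omega, hc, Or.inl rfl, ?_, hR⟩
    rw [Nat.mod_eq_of_lt hc, Nat.mod_eq_of_lt (by omega)]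
    exact insertionSort_eq_of_perm (List.Perm.refl _) (sorted (by omega) (by omega))
  have hR := hR.rotate' hV.periodic_sub
  rw [← Nat.cast_sub hc] at hR
  rcases lt_or_ge (m + b) P.size with hb | hb
  · refine ⟨m + c - P.size, m, m + b, by omega, by omega, hb, Or.inr (Or.inl rfl), ?_, hR⟩
    rw [hmod c h3 hc, Nat.mod_eq_of_lt hb]
    refine insertionSort_eq_of_perm ?_ (sorted (by omega) (by omega))
    exact (List.perm_append_comm (l₁ := [m, m + b]) (l₂ := [m + c - P.size]))
  have hR := hR.rotate' hV.periodic_sub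
  rw [← Nat.cast_sub hb] at hR
  refine ⟨m + b - P.size, m + c - P.size, m, by omega, by omega, hm, Or.inr (Or.inr rfl), ?_, hR⟩
  rw [hmod c h3 hc, hmod b (by omega) hb]
  refine insertionSort_eq_of_perm ?_ (sorted (by omega) (by omega))
  exact (List.perm_append_comm (l₁ := [m]) (l₂ := [m + b - P.size, m + c - P.size]))

theorem area_rotate (p q r : Pt) : area (q, r, p) = area (p, q, r) := by
  rw [area_eq_abs_cw, area_eq_abs_cw, cw_rotate]

theorem mem_region {p : Pt} (hp : p ∈ P) : p ∈ region P := subset_convexHull ℝ _ hp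

/-- A largest triangle is nondegenerate because three vertices of the polygon already span positive
area; its distinct offsets can then be sorted. -/
theorem exists_offsets_of_isLargest (h : IsConvexPolygon P) (a : ℕ) {T : Tri}
    (hT : IsLargest P T) :
    ∃ t₀ t₁ t₂ : ℕ, t₀ < t₁ ∧ t₁ < t₂ ∧ t₂ < P.size ∧ IsMaxAll (offs P a) t₀ t₁ t₂ ∧
      ∀ Q : Array Pt, offs P a t₀ ∈ Q → offs P a t₁ ∈ Q → offs P a t₂ ∈ Q → Aligned Q T := by
  obtain ⟨⟨hp, hq, hr⟩, hmax⟩ := hT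
  obtain ⟨p, q, r⟩ := T
  simp only at hp hq hr
  have hV := h.isCyclicConvex_offs a
  have hpos := h.size_pos
  have hmax' : ∀ x y z : ℤ, cw (offs P a x) (offs P a y) (offs P a z) ≤ |cw p q r| := by
    intro x y z
    have := hmax _ (mem_region (offs_mem hpos a x)) _ (mem_region (offs_mem hpos a y)) _
      (mem_region (offs_mem hpos a z))
    rw [area_eq_abs_cw, area_eq_abs_cw] at this
    have := le_abs_self (cw (offs P a x) (offs P a y) (offs P a z))
    linarith
  have hne : cw p q r ≠ 0 := by
    intro h0
    have h1 := hmax' 0 1 2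
    rw [h0, abs_zero] at h1
    have := h.1
    exact h1.not_gt (hV.pos (by omega) (by omega) (by omega))
  obtain ⟨i, hi, rfl⟩ := exists_offs_eq hp a
  obtain ⟨j, hj, rfl⟩ := exists_offs_eq hq a
  obtain ⟨k, hk, rfl⟩ := exists_offs_eq hr a
  have hij : i ≠ j := by rintro rfl; exact hne (cw_self_left _ _)
  have hjk : j ≠ k := by rintro rfl; exact hne (cw_self_right _ _)
  have hik : i ≠ k := by rintro rfl; exact hne (cw_self_outer _ _)
  have key : ∀ x y z : ℕ, x < y → y < z → z < P.size →
      |cw (offs P a i) (offs P a j) (offs P a k)| =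
        |cw (offs P a x) (offs P a y) (offs P a z)| → IsMaxAll (offs P a) x y z := by
    intro x y z hxy hyz hz he u v w
    rw [← abs_of_pos (hV.pos (i := x) (j := y) (k := z) (by omega) (by omega) (by omega)), ← he]
    exact hmax' u v w
  have e1 := cw_rotate (offs P a i) (offs P a j) (offs P a k)
  have e2 := cw_rotate (offs P a j) (offs P a k) (offs P a i)
  have e3 := cw_swap (offs P a i) (offs P a j) (offs P a k)
  have e4 := cw_swap (offs P a j) (offs P a k) (offs P a i)
  have e5 := cw_swap (offs P a k) (offs P a i) (offs P a j)
  rcases lt_or_gt_of_ne hij with h1 | h1 <;> rcases lt_or_gt_of_ne hjk with h2 | h2 <;>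
    rcases lt_or_gt_of_ne hik with h3 | h3
  · exact ⟨i, j, k, h1, h2, hk, key _ _ _ h1 h2 hk rfl, fun Q hx hy hz => ⟨hx, hy, hz⟩⟩
  · omega
  · exact ⟨i, k, j, h3, h2, hj, key _ _ _ h3 h2 hj (by rw [e3, abs_neg]),
      fun Q hx hy hz => ⟨hx, hz, hy⟩⟩
  · exact ⟨k, i, j, h3, h1, hj, key _ _ _ h3 h1 hj (by rw [← e1, ← e2]),
      fun Q hx hy hz => ⟨hy, hz, hx⟩⟩
  · exact ⟨j, i, k, h1, h3, hk, key _ _ _ h1 h3 hk (by rw [e4, abs_neg, e1]),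
      fun Q hx hy hz => ⟨hy, hx, hz⟩⟩
  · exact ⟨j, k, i, h2, h3, hi, key _ _ _ h2 h3 hi (by rw [e1]),
      fun Q hx hy hz => ⟨hz, hx, hy⟩⟩
  · omega
  · exact ⟨k, j, i, h2, h1, hi, key _ _ _ h2 h1 hi (by rw [e5, abs_neg, e2, e1]),
      fun Q hx hy hz => ⟨hz, hy, hx⟩⟩

theorem convexOn_area (q r : Pt) : ConvexOn ℝ Set.univ (fun p => area (p, q, r)) := by
  refine ⟨convex_univ, fun x _ y _ s t hs ht hst => ?_⟩
  simp only [area_eq_abs_cw, smul_eq_mul]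
  have : cw (s • x + t • y) q r = s * cw x q r + t * cw y q r := by
    obtain rfl : t = 1 - s := by linarith
    simp only [cw, cross, Prod.fst_add, Prod.snd_add, Prod.smul_fst, Prod.smul_snd, smul_eq_mul]
    ring
  rw [this]
  have h1 := abs_add_le (s * cw x q r) (t * cw y q r)
  rw [abs_mul, abs_mul, abs_of_nonneg hs, abs_of_nonneg ht] at h1
  linarith

theorem exists_mem_area_le {p : Pt} (hp : p ∈ region P) (q r : Pt) :
    ∃ p' ∈ P, area (p, q, r) ≤ area (p', q, r) :=
  (convexOn_area q r).exists_ge_of_mem_convexHull (Set.subset_univ _) hp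

/-- It suffices to compare with the triangles on the vertices. -/
theorem isLargest_of_forall_mem {T : Tri} (hT : Aligned P T)
    (hmax : ∀ p ∈ P, ∀ q ∈ P, ∀ r ∈ P, area (p, q, r) ≤ area T) : IsLargest P T := by
  refine ⟨hT, fun p hp q hq r hr => ?_⟩
  -- The area is convex in each vertex separately, so the three points can be moved to vertices of
  -- the polygon one after another.
  obtain ⟨p', hp', h1⟩ := exists_mem_area_le hp q r
  obtain ⟨q', hq', h2⟩ := exists_mem_area_le hq r p'
  obtain ⟨r', hr', h3⟩ := exists_mem_area_le hr p' q'
  have h4 := hmax p' hp' q' hq' r' hr'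
  linarith [area_rotate p' q r, area_rotate p' q' r, area_rotate q' r p', area_rotate q' r' p',
    area_rotate p' q' r']

theorem exists_isLargest (h : IsConvexPolygon P) : ∃ T, IsLargest P T := by
  have hfin : ({p | p ∈ P} : Set Pt).Finite := by
    have : ({p | p ∈ P} : Set Pt) = (P.toList.toFinset : Set Pt) := by ext; simp
    rw [this]
    exact Finset.finite_toSet _
  have hfin3 := hfin.prod (hfin.prod hfin)
  have hne : (({p | p ∈ P} : Set Pt) ×ˢ
      (({p | p ∈ P} : Set Pt) ×ˢ ({p | p ∈ P} : Set Pt))).Nonempty :=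
    ⟨(vtx P 0, vtx P 0, vtx P 0), vtx_mem h.size_pos _, vtx_mem h.size_pos _, vtx_mem h.size_pos _⟩
  obtain ⟨T, hT, hmax⟩ := Set.exists_max_image _ area hfin3 hne
  exact ⟨T, isLargest_of_forall_mem hT fun p hp q hq r hr => hmax (p, q, r) ⟨hp, hq, hr⟩⟩

end Optimal

/-! ### Selecting vertices -/

section Select

variable (P : Array Pt) (a : ℕ) (keep : ℕ → Prop)

theorem select_time (k : ℕ) : (select P a keep k).time ≤ 46 * k + 1 := by
  induction k with
  | zero => rw [select, ops_time]
  | succ k ih =>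
    simp only [select, bind_time, ops_time]
    split_ifs
    · rw [ops_time]; omega
    · rw [pure_time]; omega

open Classical in
theorem select_succ_val (k : ℕ) : (select P a keep (k + 1)).val =
    if keep k then (select P a keep k).val.push (vtx P (a + k)) else (select P a keep k).val := by
  simp only [select, bind_val, ops_val, decide_eq_true_eq]
  split_ifs <;> rfl

open Classical in
theorem size_select (k : ℕ) :
    (select P a keep k).val.size = ((Finset.range k).filter keep).card := by
  induction k with
  | zero => simp [select, ops_val]
  | succ k ih =>
    rw [select_succ_val, Finset.range_add_one, Finset.filter_insert]
    split_ifs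
    · rw [Array.size_push, ih, Finset.card_insert_of_notMem (by simp)]
    · exact ih

theorem mem_select {k i : ℕ} (hi : i < k) (h : keep i) : vtx P (a + i) ∈ (select P a keep k).val := by
  induction k with
  | zero => omega
  | succ k ih =>
    rw [select_succ_val]
    rcases Nat.lt_succ_iff_lt_or_eq.1 hi with hi | rfl
    · split_ifs
      · exact Array.mem_push.2 (Or.inl (ih hi))
      · exact ih hi
    · rw [if_pos h]
      exact Array.mem_push_self

theorem select_eq_subsequence (k : ℕ) : ∃ g : ℕ → ℕ,
    (∀ i j, i < j → j < (select P a keep k).val.size → g i < g j) ∧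
    ∀ i < (select P a keep k).val.size, g i < k ∧ vtx (select P a keep k).val i = vtx P (a + g i) := by
  induction k with
  | zero => exact ⟨id, by simp [select, ops_val], by simp [select, ops_val]⟩
  | succ k ih =>
    obtain ⟨g, hg, hg'⟩ := ih
    rw [select_succ_val]
    split_ifs
    · generalize (select P a keep k).val = Q at *
      refine ⟨fun i => if i < Q.size then g i else k, fun i j hij hj => ?_, fun i hi => ?_⟩
      · rw [Array.size_push] at hj
        simp only [if_pos (by omega : i < Q.size)]
        split_ifs with hj'
        · exact hg i j hij hj'
        · exact (hg' i (by omega)).1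
      · have hmod : i % (Q.push (vtx P (a + k))).size = i := Nat.mod_eq_of_lt hi
        rw [Array.size_push] at hi
        simp only
        split_ifs with hi'
        · obtain ⟨h1, h2⟩ := hg' i hi'
          refine ⟨by omega, ?_⟩
          rw [← h2]
          generalize vtx P (a + k) = v at *
          rw [vtx, hmod, vtx, Nat.mod_eq_of_lt hi']
          simp [Array.getD, hi', hi, Array.getElem_push]
        · obtain rfl : i = Q.size := by omega
          refine ⟨by omega, ?_⟩
          generalize vtx P (a + k) = v at *
          rw [vtx, hmod]
          simp [Array.getD]
    · exact ⟨g, hg, fun i hi => ⟨(hg' i hi).1.trans (Nat.lt_succ_self k), (hg' i hi).2⟩⟩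

variable {P}

theorem mem_of_mem_select (h : 0 < P.size) {k : ℕ} {p : Pt} (hp : p ∈ (select P a keep k).val) :
    p ∈ P := by
  obtain ⟨g, -, hg⟩ := select_eq_subsequence P a keep k
  obtain ⟨i, hi, rfl⟩ := Array.mem_iff_getElem.1 hp
  have := (hg i hi).2
  rw [vtx, Nat.mod_eq_of_lt hi] at this
  rw [show (select P a keep k).val[i] = (select P a keep k).val.getD i 0 by simp [Array.getD, hi],
    this]
  exact vtx_mem h _

theorem isConvexPolygon_select (h : IsConvexPolygon P)
    (h3 : 3 ≤ (select P a keep P.size).val.size) : IsConvexPolygon (select P a keep P.size).val := by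
  obtain ⟨g, hg, hg'⟩ := select_eq_subsequence P a keep P.size
  refine ⟨h3, fun i j k hij hjk hk => ?_⟩
  rw [(hg' i (by omega)).2, (hg' j (by omega)).2, (hg' k hk).2]
  have hV := (h.isCyclicConvex_offs a).pos (i := g i) (j := g j) (k := g k)
    (by have := hg i j hij (by omega); omega) (by have := hg j k hjk hk; omega)
    (by have := (hg' k hk).1; omega)
  simp only [offs_natCast, cw] at hV
  linarith

variable {a keep}

theorem size_select_of_avoidsGap {m h : ℕ} (hk : AvoidsGap m h keep) (h0 : Far m h 0)
    (hn : Far m h P.size) (hm : m < P.size) (hh : 0 < h) :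
    (select P a keep P.size).val.size + h ≤ P.size + 1 := by
  classical
  rw [size_select]
  simp only [Far] at h0 hn
  have main : ∀ s : Finset ℕ, s ⊆ Finset.range P.size → (∀ i ∈ s, ¬ keep i) → h ≤ s.card + 1 →
      ((Finset.range P.size).filter keep).card + h ≤ P.size + 1 := by
    intro s hs hks hcard
    have hd : Disjoint ((Finset.range P.size).filter keep) s :=
      Finset.disjoint_left.2 fun i hi his => hks i his (Finset.mem_filter.1 hi).2
    have := Finset.card_le_card (Finset.union_subset (Finset.filter_subset keep _) hs)
    rw [Finset.card_union_of_disjoint hd, Finset.card_range] at this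
    omega
  rcases hk with hk | hk
  · refine main (Finset.Ioo (m - h) m) (fun i hi => ?_) (fun i hi => ?_) ?_
    · rw [Finset.mem_Ioo] at hi
      rw [Finset.mem_range]
      omega
    · rw [Finset.mem_Ioo] at hi
      exact hk i (by omega) hi.2
    · rw [Nat.card_Ioo]
      omega
  · refine main (Finset.Ioo m (m + h)) (fun i hi => ?_) (fun i hi => ?_) ?_
    · rw [Finset.mem_Ioo] at hi
      rw [Finset.mem_range]
      omega
    · rw [Finset.mem_Ioo] at hi
      exact hk i hi.1 hi.2
    · rw [Nat.card_Ioo]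
      omega

theorem size_select_of_coversGap {m h : ℕ} (hk : CoversGap m h keep) (h0 : Far m h 0)
    (hn : Far m h P.size) (hm : m < P.size) (hh : 0 < h) :
    h ≤ (select P a keep P.size).val.size + 1 := by
  classical
  rw [size_select]
  simp only [Far] at h0 hn
  rcases hk with hk | hk
  · have : Finset.Ioo (m - h) m ⊆ (Finset.range P.size).filter keep := fun i hi => by
      rw [Finset.mem_Ioo] at hi
      exact Finset.mem_filter.2 ⟨Finset.mem_range.2 (by omega), hk i (by omega) hi.2⟩
    have := Finset.card_le_card this
    rw [Nat.card_Ioo] at this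
    omega
  · have : Finset.Ioo m (m + h) ⊆ (Finset.range P.size).filter keep := fun i hi => by
      rw [Finset.mem_Ioo] at hi
      exact Finset.mem_filter.2 ⟨Finset.mem_range.2 (by omega), hk i hi.1 (by omega)⟩
    have := Finset.card_le_card this
    rw [Nat.card_Ioo] at this
    omega

/-- The candidates overlap only in the six endpoints. -/
theorem size_select_add {X : ℕ → ℕ} (hX : Increasing X) :
    (select P a (KeepFirst X) P.size).val.size + (select P a (KeepSecond X) P.size).val.size ≤
      P.size + 6 := by
  classical
  rw [size_select, size_select, ← Finset.card_union_add_card_inter]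
  refine add_le_add ?_ ?_
  · conv_rhs => rw [← Finset.card_range P.size]
    exact Finset.card_le_card (Finset.union_subset (Finset.filter_subset _ _)
      (Finset.filter_subset _ _))
  · refine (Finset.card_le_card (t := (Finset.range 6).image X) fun i hi => ?_).trans
      (Finset.card_image_le.trans (by simp))
    simp only [Finset.mem_inter, Finset.mem_filter, KeepFirst, KeepSecond] at hi
    simp only [Increasing] at hX
    have : X 0 = i ∨ X 1 = i ∨ X 2 = i ∨ X 3 = i ∨ X 4 = i ∨ X 5 = i := by omega
    rw [Finset.mem_image]
    rcases this with h | h | h | h | h | h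
    exacts [⟨0, by simp, h⟩, ⟨1, by simp, h⟩, ⟨2, by simp, h⟩, ⟨3, by simp, h⟩, ⟨4, by simp, h⟩,
      ⟨5, by simp, h⟩]

theorem three_le_size_select {x y z : ℕ} (hxy : x < y) (hyz : y < z) (hz : z < P.size)
    (hx' : keep x) (hy' : keep y) (hz' : keep z) : 3 ≤ (select P a keep P.size).val.size := by
  classical
  rw [size_select]
  have : ({x, y, z} : Finset ℕ) ⊆ (Finset.range P.size).filter keep := by
    intro i hi
    simp only [Finset.mem_insert, Finset.mem_singleton] at hi
    rw [Finset.mem_filter, Finset.mem_range]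
    rcases hi with rfl | rfl | rfl
    exacts [⟨by omega, hx'⟩, ⟨by omega, hy'⟩, ⟨hz, hz'⟩]
  have := Finset.card_le_card this
  rwa [Finset.card_eq_three.2 ⟨x, y, z, by omega, by omega, by omega, rfl⟩] at this

end Select

/-! ### Dividing -/

section Divide

variable (P : Array Pt) (a : ℕ)

/-- The offsets of the first dividing triangle. -/
noncomputable def firstTriple : List ℕ := [0, (rootedOffsets P a).val.1, (rootedOffsets P a).val.2]

/-- The longest interval cut out by the first dividing triangle. -/
noncomputable def longestArc : ℕ × ℕ :=
  longestInterval P.size (rootedOffsets P a).val.1 (rootedOffsets P a).val.2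

/-- The offset of the median of the longest interval. -/
noncomputable def medianOffset : ℕ := (longestArc P a).1 + (longestArc P a).2 / 2

/-- The other two vertices of the second dividing triangle, as offsets from its root. -/
noncomputable def medianTriangle : ℕ × ℕ := (rootedOffsets P ((a + medianOffset P a) % P.size)).val

/-- The offsets of the second dividing triangle. -/
noncomputable def secondTriple : List ℕ :=
  List.insertionSort (· ≤ ·) [medianOffset P a,
    (medianOffset P a + (medianTriangle P a).1) % P.size,
    (medianOffset P a + (medianTriangle P a).2) % P.size]

/-- The six vertices of the dividing triangles in order. -/
noncomputable def mergedOffset (i : ℕ) : ℕ :=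
  (List.insertionSort (· ≤ ·) (firstTriple P a ++ secondTriple P a)).getD i 0

/-- The first candidate. -/
noncomputable def firstPart : Array Pt := (select P a (KeepFirst (mergedOffset P a)) P.size).val

/-- The second candidate. -/
noncomputable def secondPart : Array Pt := (select P a (KeepSecond (mergedOffset P a)) P.size).val

open Classical in
theorem divide_val : (divide P a).val =
    if Interleave (firstTriple P a) (secondTriple P a) then .two (firstPart P a) (secondPart P a)
    else if FirstMixed (firstTriple P a) (secondTriple P a) (mergedOffset P a) then
      .one (firstPart P a) else .one (secondPart P a) := by
  have e : (divide P a).val =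
      (if decide (Interleave (firstTriple P a) (secondTriple P a)) = true then
        (pure (.two (firstPart P a) (secondPart P a)) : Timed Split)
      else do
        let first ← ops 100
          (decide (Mixed (firstTriple P a) (secondTriple P a) (mergedOffset P a 1)
              (mergedOffset P a 2) ∧
            Mixed (firstTriple P a) (secondTriple P a) (mergedOffset P a 3) (mergedOffset P a 4) ∧
            Mixed (firstTriple P a) (secondTriple P a) (mergedOffset P a 5) (mergedOffset P a 0)))
        if first = true then pure (.one (firstPart P a)) else pure (.one (secondPart P a))).val := rfl
  rw [e]
  simp only [decide_eq_true_eq]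
  split_ifs with h1 h2
  · rfl
  · simp only [bind_val, ops_val, decide_eq_true_eq]
    rw [FirstMixed] at h2
    rw [if_pos h2, pure_val]
  · simp only [bind_val, ops_val, decide_eq_true_eq]
    rw [FirstMixed] at h2
    rw [if_neg h2, pure_val]

open Classical in
theorem divide_time (h : IsConvexPolygon P) : (divide P a).time ≤ 680 * P.size := by
  have h1 := rootedOffsets_time h a
  have h2 := rootedOffsets_time h ((a + medianOffset P a) % P.size)
  have h3 := select_time P a (KeepFirst (mergedOffset P a)) P.size
  have h4 := select_time P a (KeepSecond (mergedOffset P a)) P.size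
  have h5 := h.1
  have e : (divide P a).time = (rootedOffsets P a).time + (12 + (2 + (2 +
      ((rootedOffsets P ((a + medianOffset P a) % P.size)).time + (3 + (30 + (60 +
      ((select P a (KeepFirst (mergedOffset P a)) P.size).time +
      ((select P a (KeepSecond (mergedOffset P a)) P.size).time + (100 +
      (if decide (Interleave (firstTriple P a) (secondTriple P a)) = true then
        (pure (.two (firstPart P a) (secondPart P a)) : Timed Split)
      else do
        let first ← ops 100
          (decide (Mixed (firstTriple P a) (secondTriple P a) (mergedOffset P a 1)
              (mergedOffset P a 2) ∧
            Mixed (firstTriple P a) (secondTriple P a) (mergedOffset P a 3) (mergedOffset P a 4) ∧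
            Mixed (firstTriple P a) (secondTriple P a) (mergedOffset P a 5) (mergedOffset P a 0)))
        if first = true then pure (.one (firstPart P a))
        else pure (.one (secondPart P a))).time)))))))))) := rfl
  rw [e]
  split_ifs
  · rw [pure_time]
    omega
  · rw [bind_time, ops_time]
    split_ifs
    · rw [pure_time]
      omega
    · rw [pure_time]
      omega

variable {P}

/-- A longest interval has length `ℓ` with `n ≤ 3 ℓ` and `ℓ ≤ 2 h + 1`. For `n ≥ 4` it has at least
two edges, so the median is not an endpoint. -/
theorem median_spec {n b c : ℕ} (hb : 0 < b) (hbc : b < c) (hc : c < n) (hn : 4 ≤ n) {m h : ℕ}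
    (hh : h = (longestInterval n b c).2 / 2) (hm : m = (longestInterval n b c).1 + h) :
    0 < h ∧ n ≤ 6 * h + 3 ∧ m < n ∧ Far m h 0 ∧ Far m h b ∧ Far m h c ∧ Far m h n := by
  simp only [Far]
  rw [longestInterval] at hh hm
  split_ifs at hh hm <;> simp only at hh hm <;> omega

theorem Increasing.keep {X : ℕ → ℕ} {a₀ a₁ a₂ m₀ m₁ m₂ : ℕ} (hX : Increasing X)
    (h : EvenPattern a₀ a₁ a₂ m₀ m₁ m₂ X ∨ OddPattern a₀ a₁ a₂ m₀ m₁ m₂ X) :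
    (KeepFirst X a₀ ∧ KeepFirst X a₁ ∧ KeepFirst X a₂) ∧
      KeepSecond X a₀ ∧ KeepSecond X a₁ ∧ KeepSecond X a₂ := by
  simp only [Increasing, EvenPattern, OddPattern, IsPair, KeepFirst, KeepSecond] at *
  omega

theorem divide_spec (h : IsConvexPolygon P) (hn : 4 ≤ P.size) (a : ℕ) :
    (∃ g, P.size ≤ 6 * g + 3 ∧
      (∀ Q ∈ (divide P a).val.parts, IsConvexPolygon Q ∧ (∀ p ∈ Q, p ∈ P) ∧
        Q.size + g ≤ P.size + 1) ∧
      (∀ Q R, (divide P a).val = .two Q R →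
        Q.size + R.size ≤ P.size + 6 ∧ g ≤ Q.size + 1 ∧ g ≤ R.size + 1)) ∧
    ∀ T : Tri, IsLargest P T → ∃ Q ∈ (divide P a).val.parts, Aligned Q T := by
  classical
  have hV := h.isCyclicConvex_offs a
  obtain ⟨⟨ha1, ha2, ha3⟩, -⟩ := rootedOffsets_spec h a
  have hA : IsMaxRooted (offs P a) (0 : ℕ) (rootedOffsets P a).val.1 (rootedOffsets P a).val.2 :=
    Or.inl (isMaxThrough_rootedOffsets h a)
  have eA : firstTriple P a = [0, (rootedOffsets P a).val.1, (rootedOffsets P a).val.2] := rfl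
  obtain ⟨g, hg⟩ : ∃ g, g = (longestArc P a).2 / 2 := ⟨_, rfl⟩
  obtain ⟨m, hm⟩ : ∃ m, m = medianOffset P a := ⟨_, rfl⟩
  obtain ⟨g0, g6, hmn, far0, far1, far2, farn⟩ :=
    median_spec ha1 ha2 ha3 hn hg (hm.trans (by rw [hg]; rfl))
  obtain ⟨m₀, m₁, m₂, hm1, hm2, hm3, hmem, eM, hM⟩ :=
    exists_sorted_rootedOffsets h a hmn (o := medianTriangle P a) (by rw [hm]; rfl)
  have eM : secondTriple P a = [m₀, m₁, m₂] := by rw [← eM, hm]; rfl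
  have eX : mergedOffset P a = fun i => (List.insertionSort (· ≤ ·)
      ([0, (rootedOffsets P a).val.1, (rootedOffsets P a).val.2] ++ [m₀, m₁, m₂])).getD i 0 := by
    rw [← eA, ← eM]; rfl
  have eD := divide_val P a
  rw [eA, eM] at eD
  have e1 : firstPart P a = (select P a (KeepFirst (mergedOffset P a)) P.size).val := rfl
  have e2 : secondPart P a = (select P a (KeepSecond (mergedOffset P a)) P.size).val := rfl
  generalize mergedOffset P a = X at *
  generalize (rootedOffsets P a).val.1 = a₁ at *
  generalize (rootedOffsets P a).val.2 = a₂ at *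
  generalize firstPart P a = Q₁ at *
  generalize secondPart P a = Q₂ at *
  generalize divide P a = D at *
  have pattern : ∀ T, IsLargest P T → Increasing X ∧
      (EvenPattern 0 a₁ a₂ m₀ m₁ m₂ X ∧ Aligned Q₂ T ∨
        OddPattern 0 a₁ a₂ m₀ m₁ m₂ X ∧ Aligned Q₁ T) := by
    intro T hT
    obtain ⟨t₀, t₁, t₂, ht1, ht2, ht3, hmax, hal⟩ := exists_offsets_of_isLargest h a hT
    have i1 := hV.interleave hA hmax ha1 ha2 (by omega) ht1 ht2 (by omega)
    have i2 := hV.interleave hM hmax hm1 hm2 (by omega) ht1 ht2 (by omega)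
    obtain ⟨hX, hp⟩ := exists_pattern ha1 ha2 hm1 hm2 ht1 ht2 i1 i2 eX
    simp only [offs_natCast] at hal
    refine ⟨hX, hp.imp (And.imp_right fun hk => hal _ ?_ ?_ ?_)
      (And.imp_right fun hk => hal _ ?_ ?_ ?_)⟩
    · rw [e2]; exact mem_select P a _ (by omega) hk.1
    · rw [e2]; exact mem_select P a _ (by omega) hk.2.1
    · rw [e2]; exact mem_select P a _ ht3 hk.2.2
    · rw [e1]; exact mem_select P a _ (by omega) hk.1
    · rw [e1]; exact mem_select P a _ (by omega) hk.2.1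
    · rw [e1]; exact mem_select P a _ ht3 hk.2.2
  refine ⟨⟨g, g6, ?_⟩, fun T hT => ?_⟩
  -- Some largest triangle exists, and its presence alone forces the even or the odd pattern on
  -- which the size bounds rest.
  · obtain ⟨T, hT⟩ := exists_isLargest h
    obtain ⟨hX, hp⟩ := pattern T hT
    have hp' := hp.imp And.left And.left
    obtain ⟨⟨k1, k2, k3⟩, k4, k5, k6⟩ := hX.keep hp'
    have good1 : AvoidsGap m g (KeepFirst X) →
        IsConvexPolygon Q₁ ∧ (∀ p ∈ Q₁, p ∈ P) ∧ Q₁.size + g ≤ P.size + 1 := by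
      intro hgap
      rw [e1]
      exact ⟨isConvexPolygon_select a _ h (three_le_size_select ha1 ha2 ha3 k1 k2 k3),
        fun p hp => mem_of_mem_select a _ h.size_pos hp,
        size_select_of_avoidsGap hgap far0 farn hmn g0⟩
    have good2 : AvoidsGap m g (KeepSecond X) →
        IsConvexPolygon Q₂ ∧ (∀ p ∈ Q₂, p ∈ P) ∧ Q₂.size + g ≤ P.size + 1 := by
      intro hgap
      rw [e2]
      exact ⟨isConvexPolygon_select a _ h (three_le_size_select ha1 ha2 ha3 k4 k5 k6),
        fun p hp => mem_of_mem_select a _ h.size_pos hp,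
        size_select_of_avoidsGap hgap far0 farn hmn g0⟩
    rw [eD]
    split_ifs with hI hF
    · obtain ⟨⟨g1, g2⟩, c1, c2⟩ := gaps_of_alternating hX
        (alternating_of_interleave hX hp' ha1 ha2 hm1 hm2 hI) hmem g0 far0 far1 far2
      refine ⟨fun Q hQ => ?_, fun Q R hQR => ?_⟩
      · simp only [Split.parts, List.mem_cons, List.not_mem_nil, or_false] at hQ
        rcases hQ with rfl | rfl
        exacts [good1 g1, good2 g2]
      · obtain ⟨rfl, rfl⟩ := Split.two.inj hQR
        rw [e1, e2]
        exact ⟨size_select_add hX, size_select_of_coversGap c1 far0 farn hmn g0,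
          size_select_of_coversGap c2 far0 farn hmn g0⟩
    · refine ⟨fun Q hQ => ?_, fun Q R hQR => by cases hQR⟩
      obtain rfl := List.mem_singleton.1 hQ
      rcases hp' with hp' | hp'
      · exact absurd (hp'.interleave hX ha1 ha2 hm1 hm2 hF) hI
      · exact good1 (hp'.avoidsGap hX hmem g0 far0 far1 far2)
    · refine ⟨fun Q hQ => ?_, fun Q R hQR => by cases hQR⟩
      obtain rfl := List.mem_singleton.1 hQ
      rcases hp' with hp' | hp'
      · exact good2 (hp'.avoidsGap hX hmem far0 far1 far2)
      · exact absurd hp'.firstMixed hF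
  · obtain ⟨hX, hp⟩ := pattern T hT
    rw [eD]
    split_ifs with hI hF
    · rcases hp with hp | hp
      · exact ⟨Q₂, by simp [Split.parts], hp.2⟩
      · exact ⟨Q₁, by simp [Split.parts], hp.2⟩
    · rcases hp with hp | hp
      · exact absurd (hp.1.interleave hX ha1 ha2 hm1 hm2 hF) hI
      · exact ⟨Q₁, by simp [Split.parts], hp.2⟩
    · rcases hp with hp | hp
      · exact ⟨Q₂, by simp [Split.parts], hp.2⟩
      · exact absurd hp.1.firstMixed hF

end Divide

/-! ### Correctness and running time of the algorithm -/

theorem larger_val (T S : Tri) :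
    ((larger T S).val = T ∨ (larger T S).val = S) ∧ area T ≤ area (larger T S).val ∧
      area S ≤ area (larger T S).val := by
  simp only [larger, bind_val, ops_val, decide_eq_true_eq]
  split_ifs with h
  · exact ⟨Or.inr rfl, h, le_rfl⟩
  · exact ⟨Or.inl rfl, le_rfl, (not_le.1 h).le⟩

theorem larger_time (T S : Tri) : (larger T S).time = 50 := by
  simp only [larger, bind_time, ops_time]
  split_ifs <;> rfl

section Roots

variable {P : Array Pt}

theorem bestOverRoots_val (h : IsConvexPolygon P) (k : ℕ) :
    Aligned P (bestOverRoots P k).val ∧ ∀ i ≤ k, ∀ q ∈ P, ∀ r ∈ P,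
      area (vtx P i, q, r) ≤ area (bestOverRoots P k).val := by
  induction k with
  | zero =>
    have := isLargestRooted_rootedTriangle h 0
    refine ⟨this.1.1, fun i hi q hq r hr => ?_⟩
    obtain rfl : i = 0 := by omega
    exact this.2 q hq r hr
  | succ k ih =>
    have hr := isLargestRooted_rootedTriangle h (k + 1)
    have e : (bestOverRoots P (k + 1)).val =
      (larger (bestOverRoots P k).val (rootedTriangle P (k + 1)).val).val := rfl
    obtain ⟨h1, h2, h3⟩ := larger_val (bestOverRoots P k).val (rootedTriangle P (k + 1)).val
    rw [← e] at h1 h2 h3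
    refine ⟨?_, fun i hi q hq s hs => ?_⟩
    · rcases h1 with h1 | h1 <;> rw [h1]
      exacts [ih.1, hr.1.1]
    · rcases Nat.le_succ_iff.1 hi with hi | rfl
      · exact (ih.2 i hi q hq s hs).trans h2
      · exact (hr.2 q hq s hs).trans h3

theorem isLargest_bestOverRoots (h : IsConvexPolygon P) :
    IsLargest P (bestOverRoots P (P.size - 1)).val := by
  obtain ⟨h1, h2⟩ := bestOverRoots_val h (P.size - 1)
  refine isLargest_of_forall_mem h1 fun p hp q hq r hr => ?_
  obtain ⟨i, hi, rfl⟩ := exists_cyc_eq hp 0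
  rw [zero_add, cyc_natCast]
  exact h2 i (by omega) q hq r hr

theorem bestOverRoots_time (h : IsConvexPolygon P) (k : ℕ) :
    (bestOverRoots P k).time ≤ (k + 1) * (204 * P.size + 62) := by
  have hr : ∀ i, (rootedTriangle P i).time ≤ 204 * P.size + 12 := fun i =>
    Nat.add_le_add_right (rootedOffsets_time h i) 12
  induction k with
  | zero => exact (hr 0).trans (by omega)
  | succ k ih =>
    have e : (bestOverRoots P (k + 1)).time = (bestOverRoots P k).time +
      ((rootedTriangle P (k + 1)).time +
        (larger (bestOverRoots P k).val (rootedTriangle P (k + 1)).val).time) := rfl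
    rw [e, larger_time]
    have := hr (k + 1)
    nlinarith

theorem IsLargest.of_aligned {Q : Array Pt} (hQ : ∀ p ∈ Q, p ∈ P) {T S : Tri} (hT : IsLargest P T)
    (hTQ : Aligned Q T) (hS : IsLargest Q S) : IsLargest P S := by
  refine ⟨⟨hQ _ hS.1.1, hQ _ hS.1.2.1, hQ _ hS.1.2.2⟩, fun p hp q hq r hr => ?_⟩
  exact (hT.2 p hp q hq r hr).trans
    (hS.2 _ (mem_region hTQ.1) _ (mem_region hTQ.2.1) _ (mem_region hTQ.2.2))

theorem IsLargest.of_area_le {T S : Tri} (hT : IsLargest P T) (hS : Aligned P S)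
    (hTS : area T ≤ area S) : IsLargest P S :=
  ⟨hS, fun p hp q hq r hr => (hT.2 p hp q hq r hr).trans hTS⟩

end Roots

section Solve

variable {choice : List Bool → ℕ} {d : ℕ} {path : List Bool} {P Q R : Array Pt}

/-- The recursive calls on the subproblems. -/
noncomputable def recurse (choice : List Bool → ℕ) (d : ℕ) (path : List Bool) :
    Split → Timed (Option Tri)
  | .one Q => solve choice d (false :: path) Q
  | .two Q R => do
    let T ← solve choice d (false :: path) Q
    let S ← solve choice d (true :: path) R
    largerResult T S

theorem solve_succ (choice : List Bool → ℕ) (d : ℕ) (path : List Bool) (P : Array Pt) :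
    solve choice (d + 1) path P = (do
      let small ← ops 1 (decide (P.size ≤ 9))
      if small then
        let T ← bestOverRoots P (P.size - 1)
        pure (some T)
      else
        let a ← ops 2 (choice path % P.size)
        let s ← divide P a
        recurse choice d path s) := rfl

theorem solve_small (h : P.size ≤ 9) :
    (solve choice (d + 1) path P).val = some (bestOverRoots P (P.size - 1)).val ∧
      (solve choice (d + 1) path P).time = 1 + (bestOverRoots P (P.size - 1)).time := by
  rw [solve_succ, decide_eq_true h]
  exact ⟨rfl, rfl⟩

theorem solve_large (h : ¬ P.size ≤ 9) :
    (solve choice (d + 1) path P).val =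
        (recurse choice d path (divide P (choice path % P.size)).val).val ∧
      (solve choice (d + 1) path P).time = 1 + (2 + ((divide P (choice path % P.size)).time +
        (recurse choice d path (divide P (choice path % P.size)).val).time)) := by
  rw [solve_succ, decide_eq_false h]
  exact ⟨rfl, rfl⟩

theorem recurse_two_time : (recurse choice d path (.two Q R)).time =
    (solve choice d (false :: path) Q).time + ((solve choice d (true :: path) R).time +
      (largerResult (solve choice d (false :: path) Q).val
        (solve choice d (true :: path) R).val).time) := rfl

theorem largerResult_time_le (T S : Option Tri) : (largerResult T S).time ≤ 50 := by
  rcases T with _ | T <;> rcases S with _ | S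
  · exact Nat.zero_le _
  · exact Nat.zero_le _
  · exact Nat.zero_le _
  · exact (larger_time T S).le

theorem solve_val (h : IsConvexPolygon P) (hd : P.size ≤ d) :
    ∃ T, (solve choice d path P).val = some T ∧ IsLargest P T := by
  induction d generalizing P path with
  | zero => exact absurd h.1 (by omega)
  | succ d ih =>
    by_cases h9 : P.size ≤ 9
    · exact ⟨_, (solve_small h9).1, isLargest_bestOverRoots h⟩
    rw [(solve_large h9).1]
    obtain ⟨⟨g, hg, hparts, -⟩, hlargest⟩ := divide_spec h (by omega) (choice path % P.size)
    obtain ⟨T, hT⟩ := exists_isLargest h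
    obtain ⟨A, hA, hTA⟩ := hlargest T hT
    generalize (divide P (choice path % P.size)).val = s at *
    have hrec : ∀ B ∈ s.parts, ∀ path', ∃ S, (solve choice d path' B).val = some S ∧ IsLargest B S :=
      -- With at least ten vertices, `n ≤ 6 g + 3` gives `g ≥ 2`, so the sizes strictly decrease and
      -- the depth bound suffices.
      fun B hB path' => ih (hparts B hB).1 (by have := (hparts B hB).2.2; omega)
    rcases s with Q | ⟨Q, R⟩
    · obtain rfl := List.mem_singleton.1 hA
      obtain ⟨S, hS, hS'⟩ := hrec A hA (false :: path)
      exact ⟨S, hS, hT.of_aligned (hparts A hA).2.1 hTA hS'⟩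
    · have hQ : Q ∈ (Split.two Q R).parts := by simp [Split.parts]
      have hR : R ∈ (Split.two Q R).parts := by simp [Split.parts]
      obtain ⟨S, hS, hS'⟩ := hrec Q hQ (false :: path)
      obtain ⟨U, hU, hU'⟩ := hrec R hR (true :: path)
      have e : (recurse choice d path (.two Q R)).val = some (larger S U).val := by
        have : (recurse choice d path (.two Q R)).val =
          (largerResult (solve choice d (false :: path) Q).val
            (solve choice d (true :: path) R).val).val := rfl
        rw [this, hS, hU]
        rfl
      refine ⟨_, e, ?_⟩
      obtain ⟨h1, h2, h3⟩ := larger_val S U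
      have hal : ∀ B ∈ (Split.two Q R).parts, ∀ W, Aligned B W → Aligned P W := fun B hB W hW =>
        ⟨(hparts B hB).2.1 _ hW.1, (hparts B hB).2.1 _ hW.2.1, (hparts B hB).2.1 _ hW.2.2⟩
      have hal' : Aligned P (larger S U).val := by
        rcases h1 with h1 | h1 <;> rw [h1]
        exacts [hal Q hQ S hS'.1, hal R hR U hU'.1]
      simp only [Split.parts, List.mem_cons, List.not_mem_nil, or_false] at hA
      rcases hA with rfl | rfl
      · exact (hT.of_aligned (hparts A hQ).2.1 hTA hS').of_area_le hal' h2
      · exact (hT.of_aligned (hparts A hR).2.1 hTA hU').of_area_le hal' h3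

theorem solve_small_time (h : IsConvexPolygon P) (h9 : P.size ≤ 9) :
    (solve choice (d + 1) path P).time ≤ 20000 := by
  rw [(solve_small h9).2]
  have h1 := bestOverRoots_time h (P.size - 1)
  have h2 : P.size - 1 + 1 = P.size := Nat.sub_add_cancel h.size_pos
  rw [h2] at h1
  have : P.size * (204 * P.size + 62) ≤ 9 * (204 * 9 + 62) :=
    Nat.mul_le_mul h9 (by omega)
  omega

/-- The recurrence for the running time, for polygons that are divided. -/
theorem solve_time_cases (h : IsConvexPolygon P) (h9 : ¬ P.size ≤ 9) :
    ∃ g, P.size ≤ 6 * g + 3 ∧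
      ((∃ Q, IsConvexPolygon Q ∧ Q.size + g ≤ P.size + 1 ∧
        (solve choice (d + 1) path P).time ≤
          (solve choice d (false :: path) Q).time + 700 * P.size) ∨
      ∃ Q R, IsConvexPolygon Q ∧ IsConvexPolygon R ∧ Q.size + g ≤ P.size + 1 ∧
        R.size + g ≤ P.size + 1 ∧ Q.size + R.size ≤ P.size + 6 ∧ g ≤ Q.size + 1 ∧ g ≤ R.size + 1 ∧
        (solve choice (d + 1) path P).time ≤ (solve choice d (false :: path) Q).time +
          (solve choice d (true :: path) R).time + 700 * P.size) := by
  obtain ⟨⟨g, hg, hparts, htwo⟩, -⟩ := divide_spec h (by omega) (choice path % P.size)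
  have ht := divide_time P (choice path % P.size) h
  rw [(solve_large h9).2]
  generalize divide P (choice path % P.size) = D at *
  obtain ⟨s, t⟩ := D
  simp only at *
  refine ⟨g, hg, ?_⟩
  rcases s with Q | ⟨Q, R⟩
  · have hQ := hparts Q (by simp [Split.parts])
    refine Or.inl ⟨Q, hQ.1, hQ.2.2, ?_⟩
    have e : (recurse choice d path (.one Q)).time = (solve choice d (false :: path) Q).time := rfl
    rw [e]
    omega
  · have hQ := hparts Q (by simp [Split.parts])
    have hR := hparts R (by simp [Split.parts])
    obtain ⟨h1, h2, h3⟩ := htwo Q R rfl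
    refine Or.inr ⟨Q, R, hQ.1, hR.1, hQ.2.2, hR.2.2, h1, h2, h3, ?_⟩
    rw [recurse_two_time]
    have := largerResult_time_le (solve choice d (false :: path) Q).val
      (solve choice d (true :: path) R).val
    omega

/-- A crude bound, used for polygons of bounded size. -/
theorem solve_time_le_pow (h : IsConvexPolygon P) :
    (solve choice d path P).time ≤ 20000 * 4 ^ P.size := by
  induction d generalizing P path with
  | zero => exact Nat.zero_le _
  | succ d ih =>
    by_cases h9 : P.size ≤ 9
    · have := solve_small_time (choice := choice) (d := d) (path := path) h h9
      have h4 : 1 ≤ 4 ^ P.size := Nat.one_le_pow _ _ (by norm_num)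
      omega
    obtain ⟨k, hk⟩ : ∃ k, P.size = k + 1 := ⟨P.size - 1, by omega⟩
    have hk4 : k < 4 ^ k := Nat.lt_pow_self (by norm_num)
    have bound : ∀ {Q : Array Pt} (path'), IsConvexPolygon Q → Q.size ≤ k →
        (solve choice d path' Q).time ≤ 20000 * 4 ^ k := fun path' hQ hQk =>
      (ih hQ).trans (Nat.mul_le_mul_left _ (Nat.pow_le_pow_right (by norm_num) hQk))
    have e4 : 4 ^ P.size = 4 * 4 ^ k := by rw [hk, pow_succ, mul_comm]
    obtain ⟨g, hg, ⟨Q, hQ, hs, ht⟩ | ⟨Q, R, hQ, hR, hs, hs', -, -, -, ht⟩⟩ :=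
      solve_time_cases (choice := choice) (d := d) (path := path) h h9
    · have := bound (false :: path) hQ (by omega)
      omega
    · have h1 := bound (false :: path) hQ (by omega)
      have h2 := bound (true :: path) hR (by omega)
      omega

/-! ### The `n log n` bound -/

theorem one_le_log_of_three_le {n : ℕ} (hn : 3 ≤ n) : 1 ≤ Real.log n := by
  rw [Real.le_log_iff_exp_le (by positivity)]
  have h3 : (3 : ℝ) ≤ n := by exact_mod_cast hn
  exact (Real.exp_one_lt_three.le).trans h3

theorem log_le_log_sub {n k : ℕ} (hk : 0 < k) (hkn : 12 * k ≤ 11 * n) :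
    Real.log k ≤ Real.log n - 1 / 12 := by
  have hn : 0 < n := by omega
  have h1 : Real.log k ≤ Real.log (11 / 12 * n) := by
    apply Real.log_le_log (by exact_mod_cast hk)
    have : (12 * k : ℝ) ≤ 11 * n := by exact_mod_cast hkn
    linarith
  rw [Real.log_mul (by norm_num) (by positivity)] at h1
  have h2 := Real.log_le_sub_one_of_pos (show (0 : ℝ) < 11 / 12 by norm_num)
  linarith

/-- Subtracting `6` absorbs the shared vertices: `(q - 6) + (r - 6) ≤ n - 6`. The maximum with `1`
keeps the bound positive for small polygons. Up to `60` vertices the exponential bound is absorbed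
into `K`. -/
theorem solve_time_le {K : ℝ} (hK : (20000 * 4 ^ 60 : ℕ) ≤ K) (h : IsConvexPolygon P) :
    ((solve choice d path P).time : ℝ) ≤ K * max ((P.size : ℝ) - 6) 1 * Real.log P.size := by
  have hK1 : (20000 : ℝ) ≤ K := le_trans (by norm_num) hK
  have hK0 : 0 ≤ K := by linarith
  induction d generalizing P path with
  | zero =>
    have := one_le_log_of_three_le h.1
    have e : (solve choice 0 path P).time = 0 := rfl
    rw [e, Nat.cast_zero]
    positivity
  | succ d ih =>
    have hlog := one_le_log_of_three_le h.1
    by_cases h60 : P.size ≤ 60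
    · have h1 := solve_time_le_pow (choice := choice) (d := d + 1) (path := path) h
      have h2 : (solve choice (d + 1) path P).time ≤ 20000 * 4 ^ 60 :=
        h1.trans (Nat.mul_le_mul_left _ (Nat.pow_le_pow_right (by norm_num) h60))
      have h3 : ((solve choice (d + 1) path P).time : ℝ) ≤ K := le_trans (by exact_mod_cast h2) hK
      have h4 : K * 1 ≤ K * max ((P.size : ℝ) - 6) 1 :=
        mul_le_mul_of_nonneg_left (le_max_right _ _) hK0
      have h5 := le_mul_of_one_le_right (hK0.trans ((mul_one K).symm.le.trans h4)) hlog
      linarith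
    have hn : (60 : ℝ) ≤ P.size := by exact_mod_cast (not_le.1 h60).le
    rw [max_eq_left (by linarith)]
    have small : ∀ {Q : Array Pt} {g : ℕ}, IsConvexPolygon Q → P.size ≤ 6 * g + 3 →
        Q.size + g ≤ P.size + 1 → Real.log Q.size ≤ Real.log P.size - 1 / 12 :=
      fun hQ hg hs => log_le_log_sub hQ.size_pos (by omega)
    -- Each subproblem has at most `11 / 12` of the vertices, which lowers the logarithm by `1 /
    -- 12`; this gain pays for the linear work of the division.
    have fin : K * ((P.size : ℝ) - 6) * (Real.log P.size - 1 / 12) + 700 * P.size ≤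
        K * ((P.size : ℝ) - 6) * Real.log P.size := by
      have : 20000 * ((P.size : ℝ) - 6) ≤ K * ((P.size : ℝ) - 6) :=
        mul_le_mul_of_nonneg_right hK1 (by linarith)
      linarith
    obtain ⟨g, hg, ⟨Q, hQ, hs, ht⟩ | ⟨Q, R, hQ, hR, hs, hs', hsum, hgQ, hgR, ht⟩⟩ :=
      solve_time_cases (choice := choice) (d := d) (path := path) h (by omega)
    · have h1 := ih (path := false :: path) hQ
      have h2 := small hQ hg hs
      have h3 : max ((Q.size : ℝ) - 6) 1 ≤ (P.size : ℝ) - 6 := by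
        have : (Q.size : ℝ) ≤ P.size := by exact_mod_cast (by omega : Q.size ≤ P.size)
        exact max_le (by linarith) (by linarith)
      have h4 : K * max ((Q.size : ℝ) - 6) 1 * Real.log Q.size ≤
          K * ((P.size : ℝ) - 6) * (Real.log P.size - 1 / 12) :=
        mul_le_mul (mul_le_mul_of_nonneg_left h3 hK0) h2
          (by linarith [one_le_log_of_three_le hQ.1]) (mul_nonneg hK0 (by linarith))
      have h5 : ((solve choice (d + 1) path P).time : ℝ) ≤
          (solve choice d (false :: path) Q).time + 700 * P.size := by exact_mod_cast ht
      linarith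
    · have h1 := ih (path := false :: path) hQ
      have h2 := ih (path := true :: path) hR
      -- The lower bounds `g ≤ Q.size + 1` and `g ≤ R.size + 1` ensure that the maximum is attained
      -- by `size - 6`, the additive branch.
      have hQ7 : (7 : ℝ) ≤ Q.size := by exact_mod_cast (by omega : 7 ≤ Q.size)
      have hR7 : (7 : ℝ) ≤ R.size := by exact_mod_cast (by omega : 7 ≤ R.size)
      rw [max_eq_left (by linarith)] at h1 h2
      have h3 := mul_le_mul_of_nonneg_left (small hQ hg hs)
        (mul_nonneg hK0 (by linarith : (0 : ℝ) ≤ Q.size - 6))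
      have h4 := mul_le_mul_of_nonneg_left (small hR hg hs')
        (mul_nonneg hK0 (by linarith : (0 : ℝ) ≤ R.size - 6))
      have hsum' : (Q.size : ℝ) + R.size ≤ P.size + 6 := by exact_mod_cast hsum
      have h5 : K * (((Q.size : ℝ) - 6) + (R.size - 6)) * (Real.log P.size - 1 / 12) ≤
          K * ((P.size : ℝ) - 6) * (Real.log P.size - 1 / 12) :=
        mul_le_mul_of_nonneg_right (mul_le_mul_of_nonneg_left (by linarith) hK0) (by linarith)
      have h6 : ((solve choice (d + 1) path P).time : ℝ) ≤
          (solve choice d (false :: path) Q).time + (solve choice d (true :: path) R).time +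
            700 * P.size := by exact_mod_cast ht
      linarith

end Solve

end InscribedTriangle

open InscribedTriangle in
theorem mainTheorem4 :
    (∀ P : Array Pt, IsConvexPolygon P →
      (∀ r < P.size, IsLargestRooted P (vtx P r) (rootedTriangle P r).val) ∧
      (4 ≤ P.size → ∀ a < P.size,
        (∀ Q ∈ (divide P a).val.parts,
          IsConvexPolygon Q ∧ (∀ p ∈ Q, p ∈ P) ∧ (Q.size : ℝ) ≤ 5 / 6 * ((P.size : ℝ) + 6)) ∧
        (∀ T : Tri, IsLargest P T → ∃ Q ∈ (divide P a).val.parts, Aligned Q T))) ∧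
    (∃ C : ℝ, ∀ P : Array Pt, IsConvexPolygon P → ∀ choice : List Bool → ℕ,
      (∃ T : Tri, (largestTriangle choice P).val = some T ∧ IsLargest P T) ∧
      ((largestTriangle choice P).time : ℝ) ≤ C * (P.size : ℝ) * Real.log (P.size : ℝ)) := by
  refine ⟨fun P h => ⟨fun r _ => isLargestRooted_rootedTriangle h r, fun hn a _ => ?_⟩,
    (20000 * 4 ^ 60 : ℕ), fun P h choice => ⟨solve_val h le_rfl, ?_⟩⟩
  · obtain ⟨⟨g, hg, hparts, -⟩, hlargest⟩ := divide_spec h hn a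
    refine ⟨fun Q hQ => ⟨(hparts Q hQ).1, (hparts Q hQ).2.1, ?_⟩, hlargest⟩
    -- Eliminating `g` leaves at most `(5 n + 9) / 6` vertices.
    have h1 : (Q.size : ℝ) + g ≤ P.size + 1 := by exact_mod_cast (hparts Q hQ).2.2
    have h2 : (P.size : ℝ) ≤ 6 * g + 3 := by exact_mod_cast hg
    linarith
  · refine (solve_time_le le_rfl h).trans ?_
    have hlog := one_le_log_of_three_le h.1
    have h3 : (3 : ℝ) ≤ P.size := by exact_mod_cast h.1
    refine mul_le_mul_of_nonneg_right (mul_le_mul_of_nonneg_left ?_ (Nat.cast_nonneg _))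
      (by linarith)
    exact max_le (by linarith) (by linarith)
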